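/- Let $0<p<1$, let $L\ge 1$ be an integer, and for $x\in\mathbb{C}$ put $$[x]=\tfrac12\sum_{n\in\mathbb{Z}}(-1)^{n-\frac12}\,p^{(n+\frac12)^2}e^{-(2n+1)x},\qquad (-1)^{n-\frac12}=e^{\mathrm{i}\pi(n-\frac12)} .$$ Let $\gamma,\tau,\mu_1,\dots,\mu_L,x_1,\dots,x_L,x_0,x_{\bar 0}\in\mathbb{C}$. Let $v_1,v_2$ be the standard basis of $\mathbb{C}^2$ and let $\mathcal{R}(x;\tau)$ be the operator on $\mathbb{C}^2\otimes\mathbb{C}^2$ whose matrix in the ordered basis $v_1\otimes v_1,\,v_1\otimes v_2,\,v_2\otimes v_1,\,v_2\otimes v_2$ is $$\mathcal{R}(x;\tau)=\begin{pmatrix}a_+&0&0&0\\0&b_+&c_+&0\\0&c_-&b_-&0\\0&0&0&a_-\end{pmatrix},\qquad a_\pm=[x+\gamma],\quad b_\pm=\frac{[\tau\mp\gamma][x]}{[\tau]},\quad c_\pm=\frac{[\tau\mp x][\gamma]}{[\tau]} .$$ On $\mathbb{C}^2\otimes(\mathbb{C}^2)^{\otimes L}$, with tensor factors numbered $0,1,\dots,L$,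 let $h_k$ act on the $k$-th factor as $\mathrm{diag}(1,-1)$, and define the monodromy matrix as the product, ordered with $i$ increasing from left to right, $$\mathcal{T}_0(x,\tau)=\mathcal{R}_{01}\Big(x-\mu_1;\tau-\gamma\sum_{k=2}^{L}h_k\Big)\,\mathcal{R}_{02}\Big(x-\mu_2;\tau-\gamma\sum_{k=3}^{L}h_k\Big)\cdots\mathcal{R}_{0L}(x-\mu_L;\tau)=\begin{pmatrix}\mathcal{A}(x,\tau)&\mathcal{B}(x,\tau)\\ \mathcal{C}(x,\tau)&\mathcal{D}(x,\tau)\end{pmatrix},$$ where the blocks refer to factor $0$ and $\mathcal{R}_{0i}$ acts on the factors $0$ and $i$. The domain-wall partition function of the elliptic solid-on-solid model is $$Z_\tau(x_1,\dots,x_L)=\langle\bar 0|\,\mathcal{B}(x_1,\tau+\gamma)\,\mathcal{B}(x_2,\tau+2\gamma)\cdots\mathcal{B}(x_L,\tau+L\gamma)\,|0\rangle,$$ where $|0\rangle=\binom{1}{0}^{\otimes L}$ and $\langle\bar 0|=(0\;\;1)^{\otimes L}$. Write $X=(x_1,\dots,x_L)$ and let $X_i^{0}$ and $X_i^{\bar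 0}$ be $X$ with the entry $x_i$ replaced by $x_0$ and by $x_{\bar 0}$, respectively. Assume that no denominator below vanishes, i.e. $[\tau+n\gamma]\neq0$ for $1\le n\le L+1$, $[x_i-x_j]\neq 0$ for $i\neq j$, and $[x_0-x_j]\neq0$, $[x_{\bar 0}-x_j]\ne0$, $[x_0-\mu_j+\gamma]\neq 0$ for all $j$ (for $1\le n\le L$ the first condition covers the denominators that contribute to the partition functions). Then $$\mathcal{M}_0\,Z_\tau(X)+\sum_{i=1}^{L}\mathcal{N}_i\,Z_\tau(X_i^{0})+\sum_{i=1}^{L}\bar{\mathcal{N}}_i\,Z_\tau(X_i^{\bar 0})=0,$$ where $$\mathcal{M}_0=\prod_{j=1}^{L}\frac{[x_0-x_j+\gamma][x_0-\mu_j][x_{\bar 0}-\mu_j+\gamma]}{[x_0-x_j][x_0-\mu_j+\gamma]}-\prod_{j=1}^{L}\frac{[x_{\bar 0}-x_j+\gamma][x_{\bar 0}-\mu_j]}{[x_{\bar 0}-x_j]},$$ $$\mathcal{N}_i=-\frac{[\gamma]\,[x_0-x_i+\tau+(L+1)\gamma]}{[\tau+(L+1)\gamma]\,[x_0-x_i]}\prod_{j=1}^{L}\frac{[x_i-\mu_j][x_{\bar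 0}-\mu_j+\gamma]}{[x_0-\mu_j+\gamma]}\prod_{\substack{j=1\\ j\neq i}}^{L}\frac{[x_i-x_j+\gamma]}{[x_i-x_j]},$$ $$\bar{\mathcal{N}}_i=\frac{[\gamma]\,[x_{\bar 0}-x_i+\tau+(L+1)\gamma]}{[\tau+(L+1)\gamma]\,[x_{\bar 0}-x_i]}\prod_{j=1}^{L}[x_i-\mu_j]\prod_{\substack{j=1\\ j\neq i}}^{L}\frac{[x_i-x_j+\gamma]}{[x_i-x_j]} .$$ -/

import Mathlib

open scoped BigOperators

noncomputable section

namespace EllipticSOS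

/-- The theta function `[x]` of nome `p`:
`[x] = (1/2) ∑_{n ∈ ℤ} (-1)^{n - 1/2} p^{(n + 1/2)^2} e^{-(2n+1)x}`,
with the principal branch `(-1)^{n - 1/2} = e^{iπ(n - 1/2)}`. -/
def theta (p : ℝ) (x : ℂ) : ℂ :=
  (1 / 2) * ∑' n : ℤ, (-1 : ℂ) ^ ((n : ℂ) - 1 / 2) *
    ((p ^ (((n : ℝ) + 1 / 2) ^ 2) : ℝ) : ℂ) * Complex.exp (-(2 * (n : ℂ) + 1) * x)

/-- The statistical weight `a_±(x, τ) = [x + γ]`. -/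
def wa (p : ℝ) (γ x : ℂ) : ℂ := theta p (x + γ)

/-- The statistical weight `b_+(x, τ) = [τ - γ] [x] / [τ]`. -/
def wbPlus (p : ℝ) (γ x τ : ℂ) : ℂ := theta p (τ - γ) * theta p x * (theta p τ)⁻¹

/-- The statistical weight `b_-(x, τ) = [τ + γ] [x] / [τ]`. -/
def wbMinus (p : ℝ) (γ x τ : ℂ) : ℂ := theta p (τ + γ) * theta p x * (theta p τ)⁻¹

/-- The statistical weight `c_+(x, τ) = [τ - x] [γ] / [τ]`. -/
def wcPlus (p : ℝ) (γ x τ : ℂ) : ℂ := theta p (τ - x) * theta p γ * (theta p τ)⁻¹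

/-- The statistical weight `c_-(x, τ) = [τ + x] [γ] / [τ]`. -/
def wcMinus (p : ℝ) (γ x τ : ℂ) : ℂ := theta p (τ + x) * theta p γ * (theta p τ)⁻¹

/-- The dynamical `R`-matrix on `ℂ² ⊗ ℂ²`, in the basis `v_a ⊗ v_b` labelled by pairs `(a, b)`;
the labels `0`, `1` stand for the basis vectors `v₁`, `v₂`.  In the lexicographic order of the
basis it is `[[a₊,0,0,0],[0,b₊,c₊,0],[0,c₋,b₋,0],[0,0,0,a₋]]`. The first argument is the row. -/
def Rmat (p : ℝ) (γ x τ : ℂ) : Matrix (Fin 2 × Fin 2) (Fin 2 × Fin 2) ℂ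
  | (0, 0), (0, 0) => wa p γ x
  | (0, 1), (0, 1) => wbPlus p γ x τ
  | (0, 1), (1, 0) => wcPlus p γ x τ
  | (1, 0), (0, 1) => wcMinus p γ x τ
  | (1, 0), (1, 0) => wbMinus p γ x τ
  | (1, 1), (1, 1) => wa p γ x
  | _, _ => 0

/-- The weight of a basis vector of `ℂ²`: the eigenvalue of `H = E₁₁ - E₂₂`. -/
def hWeight : Fin 2 → ℂ := ![1, -1]

/-- The basis of `(ℂ²)^{⊗ L}`: `s` labels `v_{s 0} ⊗ ⋯ ⊗ v_{s (L-1)}`. -/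
abbrev Config (L : ℕ) : Type := Fin L → Fin 2

/-- The operator `R_{0i}(x; τ - γ ∑_{k > i} h_k)` on `ℂ² ⊗ (ℂ²)^{⊗ L}`: it acts on the auxiliary
factor and on the `i`-th factor, and the dynamical shift is the weight of the factors to the
right of `i`, which it leaves unchanged. -/
def R0 {L : ℕ} (p : ℝ) (γ : ℂ) (i : Fin L) (x τ : ℂ) :
    Matrix (Fin 2 × Config L) (Fin 2 × Config L) ℂ :=
  fun r c =>
    if ∀ k, k ≠ i → r.2 k = c.2 k then
      Rmat p γ x (τ - γ * ∑ k ∈ Finset.univ.filter (fun k => i < k), hWeight (c.2 k))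
        (r.1, r.2 i) (c.1, c.2 i)
    else 0

/-- The dynamical monodromy matrix: the product of the `R_{0i}(x - μ_i; τ - γ ∑_{k > i} h_k)`,
with `i` increasing from left to right. -/
def monodromy {L : ℕ} (p : ℝ) (γ : ℂ) (μ : Fin L → ℂ) (x τ : ℂ) :
    Matrix (Fin 2 × Config L) (Fin 2 × Config L) ℂ :=
  (List.ofFn fun i : Fin L => R0 p γ i (x - μ i) τ).prod

/-- The operator `B(x, τ)` on `(ℂ²)^{⊗ L}`: the upper right block of the monodromy matrix. -/
def opB {L : ℕ} (p : ℝ) (γ : ℂ) (μ : Fin L → ℂ) (x τ : ℂ) :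
    Matrix (Config L) (Config L) ℂ :=
  fun r c => monodromy p γ μ x τ (0, r) (1, c)

/-- The partition function with domain-wall boundary conditions,
`Z_τ(x_1, …, x_L) = ⟨0̄| B(x_1, τ + γ) B(x_2, τ + 2γ) ⋯ B(x_L, τ + Lγ) |0⟩`,
where `|0⟩ = v₁^{⊗ L}` and `⟨0̄|` is the dual basis vector of `v₂^{⊗ L}`. -/
def Z {L : ℕ} (p : ℝ) (γ : ℂ) (μ : Fin L → ℂ) (τ : ℂ) (x : Fin L → ℂ) : ℂ :=
  (List.ofFn fun j : Fin L => opB p γ μ (x j) (τ + ((j : ℕ) + 1 : ℂ) * γ)).prod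
    (fun _ => 1) (fun _ => 0)

/-- The coefficient `M₀`; here `y` stands for `x_{0̄}`. -/
def coeffM {L : ℕ} (p : ℝ) (γ : ℂ) (μ x : Fin L → ℂ) (x₀ y : ℂ) : ℂ :=
  (∏ j, (theta p (x₀ - x j + γ) * theta p (x₀ - μ j) * theta p (y - μ j + γ)) /
      (theta p (x₀ - x j) * theta p (x₀ - μ j + γ))) -
    ∏ j, (theta p (y - x j + γ) * theta p (y - μ j)) / theta p (y - x j)

/-- The coefficient `N_i`; here `y` stands for `x_{0̄}`. -/
def coeffN {L : ℕ} (p : ℝ) (γ : ℂ) (μ : Fin L → ℂ) (τ : ℂ) (x : Fin L → ℂ) (x₀ y : ℂ)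
    (i : Fin L) : ℂ :=
  -((theta p γ * theta p (x₀ - x i + τ + ((L : ℂ) + 1) * γ)) /
      (theta p (τ + ((L : ℂ) + 1) * γ) * theta p (x₀ - x i))) *
    (∏ j, (theta p (x i - μ j) * theta p (y - μ j + γ)) / theta p (x₀ - μ j + γ)) *
    ∏ j ∈ Finset.univ.erase i, theta p (x i - x j + γ) / theta p (x i - x j)

/-- The coefficient `N̄_i`; here `y` stands for `x_{0̄}`. -/
def coeffNbar {L : ℕ} (p : ℝ) (γ : ℂ) (μ : Fin L → ℂ) (τ : ℂ) (x : Fin L → ℂ) (y : ℂ)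
    (i : Fin L) : ℂ :=
  ((theta p γ * theta p (y - x i + τ + ((L : ℂ) + 1) * γ)) /
      (theta p (τ + ((L : ℂ) + 1) * γ) * theta p (y - x i))) *
    (∏ j, theta p (x i - μ j)) *
    ∏ j ∈ Finset.univ.erase i, theta p (x i - x j + γ) / theta p (x i - x j)

end EllipticSOS

end

noncomputable section

namespace EllipticSOS

open Complex

/-! The identity comes from evaluating `⟨0̄| D(x₀, τ+γ) B(x_1, τ+2γ) ⋯ B(x_L, τ+(L+1)γ) |0⟩` in two
ways. Acting to the left, `D` has the dual reference state as eigenvector (`opD_dualVacuum`), which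
gives `∏ [x₀-μ_k+γ]` times a number `K` that does not involve `x₀`. Acting to the right, `D` is
commuted through all the `B`'s; this yields `Z_τ(X)` and the `Z_τ(X_i^0)` with explicit coefficients
(`opD_mulVec_betheFinset`). Writing this for `x₀` and for `x_{0̄}` (`dualVacuum_opD_betheVector`)
and eliminating `K` gives the theorem.

The commutation rules are entries of the exchange relation `monodromy_exchange`. It follows by
induction on the number of sites from the dynamical Yang–Baxter equation, which in turn reduces to
the three-term identity `theta_three_term`. That identity holds because `[x+y][x-y]` is a 2×2
determinant in two functions of `x` and `y`.

The algebra divides by `[τ+nγ]` for arbitrary integers `n`, so it only covers generic `τ`. Such `τ`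
are dense because the zeros of `[x]` are countable, and both sides are continuous at a `τ`
satisfying the stated conditions (`continuousAt_Z`); this extends the identity. -/

/-! ### The theta function as a Jacobi theta series: convergence and holomorphy -/

/-- The exponential form of the `n`-th term of the series of `2 [x]`. -/
def thetaTerm (p : ℝ) (x : ℂ) (n : ℤ) : ℂ :=
  cexp (Real.pi * I * (n - 1 / 2) + Real.log p * (n + 1 / 2) ^ 2 - (2 * n + 1) * x)

lemma theta_eq_tsum {p : ℝ} (hp : 0 < p) (x : ℂ) :
    theta p x = (1 / 2) * ∑' n : ℤ, thetaTerm p x n := by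
  unfold theta thetaTerm
  congr 1
  refine tsum_congr fun n => ?_
  rw [Complex.cpow_def_of_ne_zero (by norm_num), Complex.log_neg_one, Real.rpow_def_of_pos hp,
    Complex.ofReal_exp, ← Complex.exp_add, ← Complex.exp_add]
  congr 1
  push_cast
  ring

/-- The modulus `τ` with `p = exp (π i τ)`. -/
def modulus (p : ℝ) : ℂ := -(Real.log p / Real.pi : ℝ) * I

lemma modulus_im_pos {p : ℝ} (hp0 : 0 < p) (hp1 : p < 1) : 0 < (modulus p).im := by
  have h := Real.log_neg hp0 hp1
  have : (modulus p).im = -(Real.log p / Real.pi) := by simp [modulus]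
  rw [this]
  have := div_neg_of_neg_of_pos h Real.pi_pos
  linarith

lemma pi_I_mul_modulus (p : ℝ) : Real.pi * I * modulus p = Real.log p := by
  have hpi : (Real.pi : ℂ) ≠ 0 := by exact_mod_cast Real.pi_ne_zero
  unfold modulus
  push_cast
  field_simp
  rw [Complex.I_sq]
  ring

/-- The argument at which the classical theta series is evaluated. -/
def thetaArg (p : ℝ) (x : ℂ) : ℂ := 1 / 2 + modulus p / 2 + x * I / Real.pi

/-- Expanding `(n + 1/2)^2`, the sign contributes the shift `1/2` of the argument, the cross term `n
log p` the half modulus, and `e^{-2nx}` the shift `ix/π`; what does not depend on `n` is the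
prefactor. Summability and holomorphy are inherited through this formula. -/
lemma thetaTerm_eq (p : ℝ) (x : ℂ) (n : ℤ) :
    thetaTerm p x n = cexp (-(Real.pi * I / 2) + Real.log p / 4 - x) *
      jacobiTheta₂_term n (thetaArg p x) (modulus p) := by
  have hpi : (Real.pi : ℂ) ≠ 0 := by exact_mod_cast Real.pi_ne_zero
  have h := pi_I_mul_modulus p
  unfold thetaTerm jacobiTheta₂_term thetaArg
  rw [← Complex.exp_add]
  congr 1
  have h2 : 2 * Real.pi * I * n * (x * I / Real.pi) = -(2 * n * x) := by
    field_simp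
    rw [Complex.I_sq]
    ring
  linear_combination (-(n : ℂ) - n ^ 2) * h - h2

lemma summable_norm_thetaTerm {p : ℝ} (hp0 : 0 < p) (hp1 : p < 1) (x : ℂ) :
    Summable fun n => ‖thetaTerm p x n‖ := by
  simp only [thetaTerm_eq, norm_mul]
  exact ((summable_jacobiTheta₂_term_iff _ _).2 (modulus_im_pos hp0 hp1)).norm.mul_left _

lemma theta_eq_jacobiTheta₂ {p : ℝ} (hp0 : 0 < p) (x : ℂ) :
    theta p x = (1 / 2) * (cexp (-(Real.pi * I / 2) + Real.log p / 4 - x) *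
      jacobiTheta₂ (thetaArg p x) (modulus p)) := by
  rw [theta_eq_tsum hp0, jacobiTheta₂]
  simp only [thetaTerm_eq, tsum_mul_left]

lemma differentiable_theta {p : ℝ} (hp0 : 0 < p) (hp1 : p < 1) :
    Differentiable ℂ (theta p) := by
  have h : theta p = fun x => (1 / 2) * (cexp (-(Real.pi * I / 2) + Real.log p / 4 - x) *
      jacobiTheta₂ (thetaArg p x) (modulus p)) := funext fun x => theta_eq_jacobiTheta₂ hp0 x
  rw [h]
  intro x
  have h1 : DifferentiableAt ℂ (thetaArg p) x := by
    unfold thetaArg; fun_prop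
  have h2 : DifferentiableAt ℂ (fun x => jacobiTheta₂ (thetaArg p x) (modulus p)) x :=
    DifferentiableAt.comp (g := fun z => jacobiTheta₂ z (modulus p)) x
      (differentiableAt_jacobiTheta₂_fst _ (modulus_im_pos hp0 hp1)) h1
  fun_prop

lemma continuous_theta {p : ℝ} (hp0 : 0 < p) (hp1 : p < 1) : Continuous (theta p) :=
  (differentiable_theta hp0 hp1).continuous

/-! ### The product formula, the three-term identity and oddness -/

/-- The general term of the even part of the theta series of nome `√p`. -/
def evenTerm (p : ℝ) (x : ℂ) (k : ℤ) : ℂ := cexp (Real.log p * (2 * k) ^ 2 / 2 - 2 * (2 * k) * x)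

/-- The general term of the odd part of the theta series of nome `√p`. -/
def oddTerm (p : ℝ) (x : ℂ) (k : ℤ) : ℂ :=
  cexp (Real.log p * (2 * k + 1) ^ 2 / 2 - 2 * (2 * k + 1) * x)

lemma evenTerm_eq (p : ℝ) (x : ℂ) (k : ℤ) :
    evenTerm p x k = jacobiTheta₂_term k (2 * x * I / Real.pi) (2 * modulus p) := by
  have hpi : (Real.pi : ℂ) ≠ 0 := by exact_mod_cast Real.pi_ne_zero
  have h := pi_I_mul_modulus p
  unfold evenTerm jacobiTheta₂_term
  congr 1
  have h2 : 2 * Real.pi * I * k * (2 * x * I / Real.pi) = -(4 * k * x) := by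
    field_simp
    rw [Complex.I_sq]
    ring
  linear_combination (-2 * (k : ℂ) ^ 2) * h - h2

lemma oddTerm_eq (p : ℝ) (x : ℂ) (k : ℤ) :
    oddTerm p x k = cexp (Real.log p / 2 - 2 * x) *
      jacobiTheta₂_term k (modulus p + 2 * x * I / Real.pi) (2 * modulus p) := by
  have hpi : (Real.pi : ℂ) ≠ 0 := by exact_mod_cast Real.pi_ne_zero
  have h := pi_I_mul_modulus p
  unfold oddTerm jacobiTheta₂_term
  rw [← Complex.exp_add]
  congr 1
  have h2 : 2 * Real.pi * I * k * (2 * x * I / Real.pi) = -(4 * k * x) := by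
    field_simp
    rw [Complex.I_sq]
    ring
  linear_combination (-2 * (k : ℂ) ^ 2 - 2 * k) * h - h2

lemma two_mul_modulus_im_pos {p : ℝ} (hp0 : 0 < p) (hp1 : p < 1) : 0 < (2 * modulus p).im := by
  have := modulus_im_pos hp0 hp1
  simpa using this

lemma summable_norm_evenTerm {p : ℝ} (hp0 : 0 < p) (hp1 : p < 1) (x : ℂ) :
    Summable fun n => ‖evenTerm p x n‖ := by
  simp only [evenTerm_eq]
  exact ((summable_jacobiTheta₂_term_iff _ _).2 (two_mul_modulus_im_pos hp0 hp1)).norm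

lemma summable_norm_oddTerm {p : ℝ} (hp0 : 0 < p) (hp1 : p < 1) (x : ℂ) :
    Summable fun n => ‖oddTerm p x n‖ := by
  simp only [oddTerm_eq, norm_mul]
  exact ((summable_jacobiTheta₂_term_iff _ _).2 (two_mul_modulus_im_pos hp0 hp1)).norm.mul_left _

/-- The pairs `(m, n)` are split by the parity of `m + n`, so that a double series can be resummed
in the half sum and half difference of its indices. -/
lemma isCompl_range_parity :
    IsCompl (Set.range fun k : ℤ × ℤ => ((k.1 + k.2, k.1 - k.2 - 1) : ℤ × ℤ))
      (Set.range fun k : ℤ × ℤ => ((k.1 + k.2, k.1 - k.2) : ℤ × ℤ)) := by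
  constructor
  · rw [Set.disjoint_left]
    rintro _ ⟨⟨k, l⟩, rfl⟩ ⟨⟨k', l'⟩, h⟩
    simp only [Prod.mk.injEq] at h
    omega
  · rw [codisjoint_iff_le_sup]
    rintro ⟨m, n⟩ -
    rcases Int.even_or_odd' (m + n) with ⟨c, h | h⟩
    · exact Or.inr ⟨(c, m - c), by simp only [Prod.mk.injEq]; omega⟩
    · exact Or.inl ⟨(c + 1, m - c - 1), by simp only [Prod.mk.injEq]; omega⟩

lemma hasSum_of_parity {f : ℤ × ℤ → ℂ} {a b : ℂ}
    (ha : HasSum (fun k : ℤ × ℤ => f (k.1 + k.2, k.1 - k.2 - 1)) a)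
    (hb : HasSum (fun k : ℤ × ℤ => f (k.1 + k.2, k.1 - k.2)) b) : HasSum f (a + b) := by
  have i1 : Function.Injective fun k : ℤ × ℤ => ((k.1 + k.2, k.1 - k.2 - 1) : ℤ × ℤ) := by
    rintro ⟨a, b⟩ ⟨c, d⟩ h
    simp only [Prod.mk.injEq] at h ⊢
    omega
  have i2 : Function.Injective fun k : ℤ × ℤ => ((k.1 + k.2, k.1 - k.2) : ℤ × ℤ) := by
    rintro ⟨a, b⟩ ⟨c, d⟩ h
    simp only [Prod.mk.injEq] at h ⊢
    omega
  exact HasSum.add_isCompl isCompl_range_parity (i1.hasSum_range_iff.2 ha)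
    (i2.hasSum_range_iff.2 hb)

/-- In these indices the quadratic form decouples, `(k+l+1/2)^2 + (k-l-1/2)^2 = ((2k)^2 +
(2l+1)^2)/2`, and so does the linear term. The signs multiply to `e^{2πi(k-1)} = 1`; in the even
case below one factor `-1` is left over. -/
lemma thetaTerm_mul_of_odd (p : ℝ) (x y : ℂ) (k l : ℤ) :
    thetaTerm p (x + y) (k + l) * thetaTerm p (x - y) (k - l - 1) =
      evenTerm p x k * oddTerm p y l := by
  unfold thetaTerm evenTerm oddTerm
  rw [← Complex.exp_add, ← Complex.exp_add, Complex.exp_eq_exp_iff_exists_int]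
  refine ⟨k - 1, ?_⟩
  push_cast
  ring

lemma thetaTerm_mul_of_even (p : ℝ) (x y : ℂ) (k l : ℤ) :
    thetaTerm p (x + y) (k + l) * thetaTerm p (x - y) (k - l) =
      -(oddTerm p x k * evenTerm p y l) := by
  unfold thetaTerm evenTerm oddTerm
  rw [← Complex.exp_add, ← Complex.exp_add, neg_eq_neg_one_mul, ← Complex.exp_pi_mul_I,
    ← Complex.exp_add, Complex.exp_eq_exp_iff_exists_int]
  refine ⟨k - 1, ?_⟩
  push_cast
  ring

/-- Multiplying the two series and summing separately over the two parity classes factorises each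
class, leaving the determinant `E(x)O(y) - O(x)E(y)` of the even and odd parts of the series of nome
`√p`. -/
lemma theta_add_mul_theta_sub {p : ℝ} (hp0 : 0 < p) (hp1 : p < 1) (x y : ℂ) :
    theta p (x + y) * theta p (x - y) = (1 / 4) *
      ((∑' k, evenTerm p x k) * (∑' k, oddTerm p y k) -
        (∑' k, oddTerm p x k) * ∑' k, evenTerm p y k) := by
  have hf := summable_norm_thetaTerm hp0 hp1
  have he := summable_norm_evenTerm hp0 hp1
  have ho := summable_norm_oddTerm hp0 hp1
  have h1 : HasSum (fun k : ℤ × ℤ => evenTerm p x k.1 * oddTerm p y k.2)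
      ((∑' k, evenTerm p x k) * ∑' k, oddTerm p y k) := by
    rw [tsum_mul_tsum_of_summable_norm (he x) (ho y)]
    exact (summable_mul_of_summable_norm (he x) (ho y)).hasSum
  have h2 : HasSum (fun k : ℤ × ℤ => -(oddTerm p x k.1 * evenTerm p y k.2))
      (-((∑' k, oddTerm p x k) * ∑' k, evenTerm p y k)) := by
    rw [tsum_mul_tsum_of_summable_norm (ho x) (he y)]
    exact (summable_mul_of_summable_norm (ho x) (he y)).hasSum.neg
  have h3 := (summable_mul_of_summable_norm (hf (x + y)) (hf (x - y))).hasSum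
  rw [← tsum_mul_tsum_of_summable_norm (hf (x + y)) (hf (x - y))] at h3
  have h4 : HasSum (fun k : ℤ × ℤ => thetaTerm p (x + y) k.1 * thetaTerm p (x - y) k.2)
      ((∑' k, evenTerm p x k) * (∑' k, oddTerm p y k) +
        -((∑' k, oddTerm p x k) * ∑' k, evenTerm p y k)) := by
    refine hasSum_of_parity ?_ ?_
    · simpa only [thetaTerm_mul_of_odd] using h1
    · simpa only [thetaTerm_mul_of_even] using h2
  rw [theta_eq_tsum hp0, theta_eq_tsum hp0]
  have h5 := h3.unique h4
  linear_combination (1 / 4) * h5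

/-- By the determinant formula this is the Plücker relation for the 2×2 minors of a 2×4 matrix. -/
lemma theta_three_term {p : ℝ} (hp0 : 0 < p) (hp1 : p < 1) (x y z w : ℂ) :
    theta p (x + y) * theta p (x - y) * (theta p (z + w) * theta p (z - w)) -
      theta p (x + z) * theta p (x - z) * (theta p (y + w) * theta p (y - w)) +
      theta p (x + w) * theta p (x - w) * (theta p (y + z) * theta p (y - z)) = 0 := by
  simp only [theta_add_mul_theta_sub hp0 hp1]
  ring

/-- The reflection `n ↦ -n - 1` preserves `(n + 1/2)^2`, reverses `2n + 1`, and changes the phase by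
`e^{iπ(2n+1)} = -1`. -/
lemma thetaTerm_neg (p : ℝ) (x : ℂ) (n : ℤ) :
    thetaTerm p (-x) n = -thetaTerm p x (-n - 1) := by
  unfold thetaTerm
  rw [neg_eq_neg_one_mul (cexp _), ← Complex.exp_pi_mul_I, ← Complex.exp_add,
    Complex.exp_eq_exp_iff_exists_int]
  refine ⟨n, ?_⟩
  push_cast
  ring

lemma theta_neg {p : ℝ} (hp0 : 0 < p) (x : ℂ) : theta p (-x) = -theta p x := by
  rw [theta_eq_tsum hp0, theta_eq_tsum hp0]
  simp only [thetaTerm_neg, tsum_neg]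
  have e : ∑' n : ℤ, thetaTerm p x (-n - 1) = ∑' n : ℤ, thetaTerm p x n :=
    Equiv.tsum_eq ((Equiv.neg ℤ).trans (Equiv.subRight (1 : ℤ))) (thetaTerm p x)
  rw [e]
  ring

/-! ### The dynamical Yang–Baxter equation -/

/-- This and the next six lemmas are the entries of the Yang–Baxter equation with real content. With
denominators and common factors removed, each of the first six is a single three-term identity; the
half-integer combinations come from solving for `x ± y` and `z ± w` in one of its products. -/
lemma dynamicalYangBaxter_cPlus_bMinus_a {p : ℝ} (hp0 : 0 < p) (hp1 : p < 1)
    (γ t u v : ℂ) (h0 : theta p t ≠ 0)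
    (h1 : theta p (t - γ) ≠ 0) :
    wcPlus p γ u (t - γ) * wbMinus p γ (u + v) t * wa p γ v =
      wbMinus p γ v t * wa p γ (u + v) * wcPlus p γ u t +
        wcMinus p γ v t * wcPlus p γ (u + v) (t - γ) * wbMinus p γ u t := by
  have h :
      theta p t * theta p (t - γ - u) * theta p (u + v) * theta p (γ + v) -
        theta p (t - γ) * theta p (t - u) * theta p v * theta p (γ + u + v) -
        theta p γ * theta p u * theta p (t + v) * theta p (t - γ - u - v) = 0 := by
    have hh := theta_three_term hp0 hp1
      (t - 1 / 2 * γ - 1 / 2 * u) (1 / 2 * γ + 1 / 2 * u)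
      (1 / 2 * γ + 1 / 2 * u + v) (-1 / 2 * γ + 1 / 2 * u)
    rw [show (t - 1 / 2 * γ - 1 / 2 * u) + (1 / 2 * γ + 1 / 2 * u) = t by ring,
      show (t - 1 / 2 * γ - 1 / 2 * u) - (1 / 2 * γ + 1 / 2 * u) = t - γ - u by ring,
      show (1 / 2 * γ + 1 / 2 * u + v) + (-1 / 2 * γ + 1 / 2 * u) = u + v by ring,
      show (1 / 2 * γ + 1 / 2 * u + v) - (-1 / 2 * γ + 1 / 2 * u) = γ + v by ring,
      show (t - 1 / 2 * γ - 1 / 2 * u) + (1 / 2 * γ + 1 / 2 * u + v) = t + v by ring,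
      show (t - 1 / 2 * γ - 1 / 2 * u) - (1 / 2 * γ + 1 / 2 * u + v) = t - γ - u - v by ring,
      show (1 / 2 * γ + 1 / 2 * u) + (-1 / 2 * γ + 1 / 2 * u) = u by ring,
      show (1 / 2 * γ + 1 / 2 * u) - (-1 / 2 * γ + 1 / 2 * u) = γ by ring,
      show (t - 1 / 2 * γ - 1 / 2 * u) + (-1 / 2 * γ + 1 / 2 * u) = t - γ by ring,
      show (t - 1 / 2 * γ - 1 / 2 * u) - (-1 / 2 * γ + 1 / 2 * u) = t - u by ring,
      show (1 / 2 * γ + 1 / 2 * u) + (1 / 2 * γ + 1 / 2 * u + v) = γ + u + v by ring,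
      show (1 / 2 * γ + 1 / 2 * u) - (1 / 2 * γ + 1 / 2 * u + v) = -v by ring] at hh
    simp only [theta_neg hp0] at hh
    linear_combination hh
  simp only [wa, wbMinus, wcPlus, wcMinus]
  rw [show u + v + γ = γ + u + v by ring, show v + γ = γ + v by ring,
    show t - γ - (u + v) = t - γ - u - v by ring]
  field_simp
  linear_combination theta p γ * theta p (t + γ) * h

lemma dynamicalYangBaxter_a_bMinus_cMinus {p : ℝ} (hp0 : 0 < p) (hp1 : p < 1)
    (γ t u v : ℂ) (h0 : theta p t ≠ 0)
    (h1 : theta p (t - γ) ≠ 0) :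
    wcMinus p γ u (t - γ) * wa p γ (u + v) * wbMinus p γ v (t - γ) +
      wbMinus p γ u (t - γ) * wcMinus p γ (u + v) t * wcPlus p γ v (t - γ) =
      wa p γ v * wbMinus p γ (u + v) (t - γ) * wcMinus p γ u t := by
  have h :
      theta p (t - γ + u) * theta p (γ + u + v) * theta p t * theta p v +
        theta p u * theta p (t + u + v) * theta p (t - γ - v) * theta p γ -
        theta p (γ + v) * theta p (u + v) * theta p (t + u) * theta p (t - γ) = 0 := by
    have hh := theta_three_term hp0 hp1
      (1 / 2 * t + u + 1 / 2 * v) (1 / 2 * t - γ - 1 / 2 * v)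
      (1 / 2 * t + 1 / 2 * v) (1 / 2 * t - 1 / 2 * v)
    rw [show (1 / 2 * t + u + 1 / 2 * v) + (1 / 2 * t - γ - 1 / 2 * v) = t - γ + u by ring,
      show (1 / 2 * t + u + 1 / 2 * v) - (1 / 2 * t - γ - 1 / 2 * v) = γ + u + v by ring,
      show (1 / 2 * t + 1 / 2 * v) + (1 / 2 * t - 1 / 2 * v) = t by ring,
      show (1 / 2 * t + 1 / 2 * v) - (1 / 2 * t - 1 / 2 * v) = v by ring,
      show (1 / 2 * t + u + 1 / 2 * v) + (1 / 2 * t + 1 / 2 * v) = t + u + v by ring,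
      show (1 / 2 * t + u + 1 / 2 * v) - (1 / 2 * t + 1 / 2 * v) = u by ring,
      show (1 / 2 * t - γ - 1 / 2 * v) + (1 / 2 * t - 1 / 2 * v) = t - γ - v by ring,
      show (1 / 2 * t - γ - 1 / 2 * v) - (1 / 2 * t - 1 / 2 * v) = -γ by ring,
      show (1 / 2 * t + u + 1 / 2 * v) + (1 / 2 * t - 1 / 2 * v) = t + u by ring,
      show (1 / 2 * t + u + 1 / 2 * v) - (1 / 2 * t - 1 / 2 * v) = u + v by ring,
      show (1 / 2 * t - γ - 1 / 2 * v) + (1 / 2 * t + 1 / 2 * v) = t - γ by ring,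
      show (1 / 2 * t - γ - 1 / 2 * v) - (1 / 2 * t + 1 / 2 * v) = -(γ + v) by ring] at hh
    simp only [theta_neg hp0] at hh
    linear_combination hh
  simp only [wa, wbMinus, wcPlus, wcMinus]
  rw [show u + v + γ = γ + u + v by ring, show v + γ = γ + v by ring,
    show t - γ + γ = t by ring, show t + (u + v) = t + u + v by ring]
  field_simp
  linear_combination theta p γ * h

lemma dynamicalYangBaxter_cMinus_bPlus_a {p : ℝ} (hp0 : 0 < p) (hp1 : p < 1)
    (γ t u v : ℂ) (h0 : theta p t ≠ 0)
    (h1 : theta p (t - γ) ≠ 0) :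
    wbPlus p γ u (t - γ) * wa p γ (u + v) * wcMinus p γ v (t - γ) +
      wcPlus p γ u (t - γ) * wcMinus p γ (u + v) t * wbPlus p γ v (t - γ) =
      wcMinus p γ v t * wbPlus p γ (u + v) (t - γ) * wa p γ u := by
  have h :
      theta p t * theta p u * theta p (γ + u + v) * theta p (t - γ + v) +
        theta p (t - γ - u) * theta p γ * theta p (t + u + v) * theta p v -
        theta p (t - γ) * theta p (t + v) * theta p (u + v) * theta p (γ + u) = 0 := by
    have hh := theta_three_term hp0 hp1
      (1 / 2 * t + 1 / 2 * u) (1 / 2 * t - 1 / 2 * u)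
      (1 / 2 * t + 1 / 2 * u + v) (-1 / 2 * t + γ + 1 / 2 * u)
    rw [show (1 / 2 * t + 1 / 2 * u) + (1 / 2 * t - 1 / 2 * u) = t by ring,
      show (1 / 2 * t + 1 / 2 * u) - (1 / 2 * t - 1 / 2 * u) = u by ring,
      show (1 / 2 * t + 1 / 2 * u + v) + (-1 / 2 * t + γ + 1 / 2 * u) = γ + u + v by ring,
      show (1 / 2 * t + 1 / 2 * u + v) - (-1 / 2 * t + γ + 1 / 2 * u) = t - γ + v by ring,
      show (1 / 2 * t + 1 / 2 * u) + (1 / 2 * t + 1 / 2 * u + v) = t + u + v by ring,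
      show (1 / 2 * t + 1 / 2 * u) - (1 / 2 * t + 1 / 2 * u + v) = -v by ring,
      show (1 / 2 * t - 1 / 2 * u) + (-1 / 2 * t + γ + 1 / 2 * u) = γ by ring,
      show (1 / 2 * t - 1 / 2 * u) - (-1 / 2 * t + γ + 1 / 2 * u) = t - γ - u by ring,
      show (1 / 2 * t + 1 / 2 * u) + (-1 / 2 * t + γ + 1 / 2 * u) = γ + u by ring,
      show (1 / 2 * t + 1 / 2 * u) - (-1 / 2 * t + γ + 1 / 2 * u) = t - γ by ring,
      show (1 / 2 * t - 1 / 2 * u) + (1 / 2 * t + 1 / 2 * u + v) = t + v by ring,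
      show (1 / 2 * t - 1 / 2 * u) - (1 / 2 * t + 1 / 2 * u + v) = -(u + v) by ring] at hh
    simp only [theta_neg hp0] at hh
    linear_combination hh
  simp only [wa, wbPlus, wcPlus, wcMinus]
  rw [show u + v + γ = γ + u + v by ring, show u + γ = γ + u by ring,
    show t + (u + v) = t + u + v by ring]
  field_simp
  linear_combination theta p γ * theta p (t - γ - γ) * h

lemma dynamicalYangBaxter_a_cMinus_a_left {p : ℝ} (hp0 : 0 < p) (hp1 : p < 1)
    (γ t u v : ℂ) (h0 : theta p t ≠ 0)
    (h1 : theta p (t - γ) ≠ 0) :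
    wcMinus p γ u (t - γ) * wa p γ (u + v) * wcMinus p γ v (t - γ) +
      wbMinus p γ u (t - γ) * wcMinus p γ (u + v) t * wbPlus p γ v (t - γ) =
      wa p γ v * wcMinus p γ (u + v) (t - γ) * wa p γ u := by
  have h :
      theta p (t - γ + u) * theta p γ * theta p (γ + u + v) * theta p (t - γ + v) +
        theta p u * theta p (t + u + v) * theta p (t - 2 * γ) * theta p v -
        theta p (t - γ) * theta p (γ + v) * theta p (γ + u) * theta p (t - γ + u + v) = 0 := by
    have hh := theta_three_term hp0 hp1
      (1 / 2 * t + 1 / 2 * u) (1 / 2 * t - γ + 1 / 2 * u)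
      (1 / 2 * t + 1 / 2 * u + v) (-1 / 2 * t + γ + 1 / 2 * u)
    rw [show (1 / 2 * t + 1 / 2 * u) + (1 / 2 * t - γ + 1 / 2 * u) = t - γ + u by ring,
      show (1 / 2 * t + 1 / 2 * u) - (1 / 2 * t - γ + 1 / 2 * u) = γ by ring,
      show (1 / 2 * t + 1 / 2 * u + v) + (-1 / 2 * t + γ + 1 / 2 * u) = γ + u + v by ring,
      show (1 / 2 * t + 1 / 2 * u + v) - (-1 / 2 * t + γ + 1 / 2 * u) = t - γ + v by ring,
      show (1 / 2 * t + 1 / 2 * u) + (1 / 2 * t + 1 / 2 * u + v) = t + u + v by ring,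
      show (1 / 2 * t + 1 / 2 * u) - (1 / 2 * t + 1 / 2 * u + v) = -v by ring,
      show (1 / 2 * t - γ + 1 / 2 * u) + (-1 / 2 * t + γ + 1 / 2 * u) = u by ring,
      show (1 / 2 * t - γ + 1 / 2 * u) - (-1 / 2 * t + γ + 1 / 2 * u) = t - 2 * γ by ring,
      show (1 / 2 * t + 1 / 2 * u) + (-1 / 2 * t + γ + 1 / 2 * u) = γ + u by ring,
      show (1 / 2 * t + 1 / 2 * u) - (-1 / 2 * t + γ + 1 / 2 * u) = t - γ by ring,
      show (1 / 2 * t - γ + 1 / 2 * u) + (1 / 2 * t + 1 / 2 * u + v) = t - γ + u + v by ring,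
      show (1 / 2 * t - γ + 1 / 2 * u) - (1 / 2 * t + 1 / 2 * u + v) = -(γ + v) by ring] at hh
    simp only [theta_neg hp0] at hh
    linear_combination hh
  rw [show t - 2 * γ = t - γ - γ by ring] at h
  simp only [wa, wbPlus, wbMinus, wcMinus]
  rw [show u + v + γ = γ + u + v by ring, show v + γ = γ + v by ring,
    show u + γ = γ + u by ring, show t - γ + γ = t by ring,
    show t + (u + v) = t + u + v by ring, show t - γ + (u + v) = t - γ + u + v by ring]
  field_simp
  linear_combination theta p γ * h

lemma dynamicalYangBaxter_a_cMinus_a_right {p : ℝ} (hp0 : 0 < p) (hp1 : p < 1)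
    (γ t u v : ℂ) (h0 : theta p t ≠ 0)
    (h2 : theta p (t + γ) ≠ 0) :
    wa p γ u * wcMinus p γ (u + v) t * wa p γ v =
      wbMinus p γ v t * wcMinus p γ (u + v) (t + γ) * wbPlus p γ u t +
        wcMinus p γ v t * wa p γ (u + v) * wcMinus p γ u t := by
  have h :
      theta p t * theta p (t + u + v) * theta p (γ + u) * theta p (γ + v) -
        theta p v * theta p (t + γ + u + v) * theta p (t - γ) * theta p u -
        theta p (t + v) * theta p (γ + u + v) * theta p (t + u) * theta p γ = 0 := by
    have hh := theta_three_term hp0 hp1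
      (t + 1 / 2 * u + 1 / 2 * v) (-1 / 2 * u - 1 / 2 * v)
      (γ + 1 / 2 * u + 1 / 2 * v) (1 / 2 * u - 1 / 2 * v)
    rw [show (t + 1 / 2 * u + 1 / 2 * v) + (-1 / 2 * u - 1 / 2 * v) = t by ring,
      show (t + 1 / 2 * u + 1 / 2 * v) - (-1 / 2 * u - 1 / 2 * v) = t + u + v by ring,
      show (γ + 1 / 2 * u + 1 / 2 * v) + (1 / 2 * u - 1 / 2 * v) = γ + u by ring,
      show (γ + 1 / 2 * u + 1 / 2 * v) - (1 / 2 * u - 1 / 2 * v) = γ + v by ring,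
      show (t + 1 / 2 * u + 1 / 2 * v) + (γ + 1 / 2 * u + 1 / 2 * v) = t + γ + u + v by ring,
      show (t + 1 / 2 * u + 1 / 2 * v) - (γ + 1 / 2 * u + 1 / 2 * v) = t - γ by ring,
      show (-1 / 2 * u - 1 / 2 * v) + (1 / 2 * u - 1 / 2 * v) = -v by ring,
      show (-1 / 2 * u - 1 / 2 * v) - (1 / 2 * u - 1 / 2 * v) = -u by ring,
      show (t + 1 / 2 * u + 1 / 2 * v) + (1 / 2 * u - 1 / 2 * v) = t + u by ring,
      show (t + 1 / 2 * u + 1 / 2 * v) - (1 / 2 * u - 1 / 2 * v) = t + v by ring,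
      show (-1 / 2 * u - 1 / 2 * v) + (γ + 1 / 2 * u + 1 / 2 * v) = γ by ring,
      show (-1 / 2 * u - 1 / 2 * v) - (γ + 1 / 2 * u + 1 / 2 * v) = -(γ + u + v) by ring] at hh
    simp only [theta_neg hp0] at hh
    linear_combination hh
  simp only [wa, wbPlus, wbMinus, wcMinus]
  rw [show u + v + γ = γ + u + v by ring, show v + γ = γ + v by ring,
    show u + γ = γ + u by ring,
    show t + (u + v) = t + u + v by ring, show t + γ + (u + v) = t + γ + u + v by ring]
  field_simp
  linear_combination theta p γ * h

lemma dynamicalYangBaxter_a_bMinus_cMinus_shift {p : ℝ} (hp0 : 0 < p) (hp1 : p < 1)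
    (γ t u v : ℂ) (h0 : theta p t ≠ 0)
    (h2 : theta p (t + γ) ≠ 0) :
    wa p γ u * wbMinus p γ (u + v) t * wcMinus p γ v (t + γ) =
      wbMinus p γ v t * wcMinus p γ (u + v) (t + γ) * wcPlus p γ u t +
        wcMinus p γ v t * wa p γ (u + v) * wbMinus p γ u t := by
  have h :
      theta p t * theta p (γ + u) * theta p (u + v) * theta p (t + γ + v) -
        theta p v * theta p (t + γ + u + v) * theta p (t - u) * theta p γ -
        theta p (t + v) * theta p (γ + u + v) * theta p (t + γ) * theta p u = 0 := by
    have hh := theta_three_term hp0 hp1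
      (1 / 2 * t + 1 / 2 * γ + 1 / 2 * u) (1 / 2 * t - 1 / 2 * γ - 1 / 2 * u)
      (1 / 2 * t + 1 / 2 * γ + 1 / 2 * u + v) (-1 / 2 * t - 1 / 2 * γ + 1 / 2 * u)
    rw [show (1 / 2 * t + 1 / 2 * γ + 1 / 2 * u) + (1 / 2 * t - 1 / 2 * γ - 1 / 2 * u) =
        t by ring,
      show (1 / 2 * t + 1 / 2 * γ + 1 / 2 * u) - (1 / 2 * t - 1 / 2 * γ - 1 / 2 * u) =
        γ + u by ring,
      show (1 / 2 * t + 1 / 2 * γ + 1 / 2 * u + v) + (-1 / 2 * t - 1 / 2 * γ + 1 / 2 * u) =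
        u + v by ring,
      show (1 / 2 * t + 1 / 2 * γ + 1 / 2 * u + v) - (-1 / 2 * t - 1 / 2 * γ + 1 / 2 * u) =
        t + γ + v by ring,
      show (1 / 2 * t + 1 / 2 * γ + 1 / 2 * u) + (1 / 2 * t + 1 / 2 * γ + 1 / 2 * u + v) =
        t + γ + u + v by ring,
      show (1 / 2 * t + 1 / 2 * γ + 1 / 2 * u) - (1 / 2 * t + 1 / 2 * γ + 1 / 2 * u + v) =
        -v by ring,
      show (1 / 2 * t - 1 / 2 * γ - 1 / 2 * u) + (-1 / 2 * t - 1 / 2 * γ + 1 / 2 * u) =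
        -γ by ring,
      show (1 / 2 * t - 1 / 2 * γ - 1 / 2 * u) - (-1 / 2 * t - 1 / 2 * γ + 1 / 2 * u) =
        t - u by ring,
      show (1 / 2 * t + 1 / 2 * γ + 1 / 2 * u) + (-1 / 2 * t - 1 / 2 * γ + 1 / 2 * u) = u by ring,
      show (1 / 2 * t + 1 / 2 * γ + 1 / 2 * u) - (-1 / 2 * t - 1 / 2 * γ + 1 / 2 * u) =
        t + γ by ring,
      show (1 / 2 * t - 1 / 2 * γ - 1 / 2 * u) + (1 / 2 * t + 1 / 2 * γ + 1 / 2 * u + v) =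
        (t + v)  by ring,
      show (1 / 2 * t - 1 / 2 * γ - 1 / 2 * u) - (1 / 2 * t + 1 / 2 * γ + 1 / 2 * u + v) =
        -(γ + u + v) by ring] at hh
    simp only [theta_neg hp0] at hh
    linear_combination hh
  simp only [wa, wbMinus, wcPlus, wcMinus]
  rw [show u + v + γ = γ + u + v by ring,
    show u + γ = γ + u by ring,
    show t + γ + (u + v) = t + γ + u + v by ring]
  field_simp
  linear_combination theta p γ * h

/-- The only entry that needs two three-term identities: one is independent of the spectral
parameters, and the auxiliary factor `[2t - γ]` occurring in both cancels in their combination. -/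
lemma dynamicalYangBaxter_b_a_b_c_c_c {p : ℝ} (hp0 : 0 < p) (hp1 : p < 1)
    (γ t u v : ℂ) (h0 : theta p t ≠ 0)
    (h1 : theta p (t - γ) ≠ 0) :
    wbPlus p γ u (t - γ) * wa p γ (u + v) * wbMinus p γ v (t - γ) +
      wcPlus p γ u (t - γ) * wcMinus p γ (u + v) t * wcPlus p γ v (t - γ) =
      wbMinus p γ v t * wa p γ (u + v) * wbPlus p γ u t +
        wcMinus p γ v t * wcPlus p γ (u + v) (t - γ) * wcMinus p γ u t := by
  have h :
      theta p t * theta p t * theta p t * theta p (t - 2 * γ) -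
        theta p (t - γ) * theta p (t - γ) * theta p (t - γ) * theta p (t + γ) +
        theta p γ * theta p γ * theta p γ * theta p (2 * t - γ) = 0 := by
    have hh := theta_three_term hp0 hp1 t 0 (t - γ) γ
    rw [show t + 0 = t by ring,
      show t - 0 = t by ring,
      show (t - γ) + γ = t by ring,
      show (t - γ) - γ = t - 2 * γ by ring,
      show t + (t - γ) = 2 * t - γ by ring,
      show t - (t - γ) = γ by ring,
      show 0 + γ = γ by ring,
      show 0 - γ = -γ by ring,
      show t + γ = t + γ by ring,
      show t - γ = t - γ by ring,
      show 0 + (t - γ) = t - γ by ring,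
      show 0 - (t - γ) = -(t - γ) by ring] at hh
    simp only [theta_neg hp0] at hh
    linear_combination hh
  have h' :
      theta p (t - γ) * theta p (t + v) * theta p (t + u) * theta p (t - γ - u - v) -
        theta p t * theta p (t - γ - u) * theta p (t - γ - v) * theta p (t + u + v) +
        theta p (2 * t - γ) * theta p u * theta p v * theta p (γ + u + v) = 0 := by
    have hh := theta_three_term hp0 hp1
      (t - 1 / 2 * γ + 1 / 2 * v) (-1 / 2 * γ - 1 / 2 * v)
      (t - 1 / 2 * γ - 1 / 2 * v) (1 / 2 * γ + u + 1 / 2 * v)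
    rw [show (t - 1 / 2 * γ + 1 / 2 * v) + (-1 / 2 * γ - 1 / 2 * v) = t - γ by ring,
      show (t - 1 / 2 * γ + 1 / 2 * v) - (-1 / 2 * γ - 1 / 2 * v) = t + v by ring,
      show (t - 1 / 2 * γ - 1 / 2 * v) + (1 / 2 * γ + u + 1 / 2 * v) = t + u by ring,
      show (t - 1 / 2 * γ - 1 / 2 * v) - (1 / 2 * γ + u + 1 / 2 * v) = t - γ - u - v by ring,
      show (t - 1 / 2 * γ + 1 / 2 * v) + (t - 1 / 2 * γ - 1 / 2 * v) = 2 * t - γ by ring,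
      show (t - 1 / 2 * γ + 1 / 2 * v) - (t - 1 / 2 * γ - 1 / 2 * v) = v by ring,
      show (-1 / 2 * γ - 1 / 2 * v) + (1 / 2 * γ + u + 1 / 2 * v) = u by ring,
      show (-1 / 2 * γ - 1 / 2 * v) - (1 / 2 * γ + u + 1 / 2 * v) = -(γ + u + v) by ring,
      show (t - 1 / 2 * γ + 1 / 2 * v) + (1 / 2 * γ + u + 1 / 2 * v) = t + u + v by ring,
      show (t - 1 / 2 * γ + 1 / 2 * v) - (1 / 2 * γ + u + 1 / 2 * v) = t - γ - u by ring,
      show (-1 / 2 * γ - 1 / 2 * v) + (t - 1 / 2 * γ - 1 / 2 * v) = t - γ - v by ring,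
      show (-1 / 2 * γ - 1 / 2 * v) - (t - 1 / 2 * γ - 1 / 2 * v) = -t by ring] at hh
    simp only [theta_neg hp0] at hh
    linear_combination hh
  simp only [wa, wbPlus, wbMinus, wcPlus, wcMinus]
  rw [show u + v + γ = γ + u + v by ring, show t - γ + γ = t by ring,
    show t - γ - γ = t - 2 * γ by ring, show t - γ - (u + v) = t - γ - u - v by ring,
    show t + (u + v) = t + u + v by ring]
  field_simp
  linear_combination theta p u * theta p v * theta p (γ + u + v) * h - theta p γ ^ 3 * h'

/-- The flip of the label of a basis vector of `ℂ²`. -/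
def flip : Fin 2 → Fin 2 := ![1, 0]

lemma hWeight_flip (a : Fin 2) : hWeight (flip a) = -hWeight a := by
  fin_cases a <;> simp [hWeight, flip]

lemma flip_flip (a : Fin 2) : flip (flip a) = a := by
  fin_cases a <;> rfl

/-- The flip as a permutation of the labels. -/
def flipEquiv : Fin 2 ≃ Fin 2 := ⟨flip, flip, flip_flip, flip_flip⟩

/-- Since `[x]` is odd, `t ↦ -t` exchanges `b_±` and `c_±`, the signs of numerator and denominator
cancelling. This symmetry halves the entries of the Yang–Baxter equation to be checked. -/
lemma Rmat_flip {p : ℝ} (hp0 : 0 < p) (γ x t : ℂ) (a b c d : Fin 2) :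
    Rmat p γ x t (flip a, flip b) (flip c, flip d) = Rmat p γ x (-t) (a, b) (c, d) := by
  have h (y : ℂ) : theta p (-t - y) = -theta p (t + y) := by rw [← theta_neg hp0, neg_add']
  have h' (y : ℂ) : theta p (-t + y) = -theta p (t - y) := by
    rw [← theta_neg hp0, neg_sub', sub_neg_eq_add]
  fin_cases a <;> fin_cases b <;> fin_cases c <;> fin_cases d <;>
    simp [Rmat, flip, wbPlus, wbMinus, wcPlus, wcMinus, theta_neg hp0, h, h', inv_neg,
      -neg_add_rev]

lemma Rmat_entries (p : ℝ) (γ x t : ℂ) :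
    Rmat p γ x t (0, 0) (0, 0) = wa p γ x ∧
    Rmat p γ x t (0, 0) (0, 1) = 0 ∧
    Rmat p γ x t (0, 0) (1, 0) = 0 ∧
    Rmat p γ x t (0, 0) (1, 1) = 0 ∧
    Rmat p γ x t (0, 1) (0, 0) = 0 ∧
    Rmat p γ x t (0, 1) (0, 1) = wbPlus p γ x t ∧
    Rmat p γ x t (0, 1) (1, 0) = wcPlus p γ x t ∧
    Rmat p γ x t (0, 1) (1, 1) = 0 ∧
    Rmat p γ x t (1, 0) (0, 0) = 0 ∧
    Rmat p γ x t (1, 0) (0, 1) = wcMinus p γ x t ∧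
    Rmat p γ x t (1, 0) (1, 0) = wbMinus p γ x t ∧
    Rmat p γ x t (1, 0) (1, 1) = 0 ∧
    Rmat p γ x t (1, 1) (0, 0) = 0 ∧
    Rmat p γ x t (1, 1) (0, 1) = 0 ∧
    Rmat p γ x t (1, 1) (1, 0) = 0 ∧
    Rmat p γ x t (1, 1) (1, 1) = wa p γ x :=
  ⟨rfl, rfl, rfl, rfl, rfl, rfl, rfl, rfl, rfl, rfl, rfl, rfl, rfl, rfl, rfl, rfl⟩

/-- The weights of two auxiliary lines with spectral parameters `x₁`, `x₂` crossing a site,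
which goes from `c` to `r`. -/
def siteWeight (p : ℝ) (γ x₁ x₂ t : ℂ) (r c : Fin 2) :
    Matrix (Fin 2 × Fin 2) (Fin 2 × Fin 2) ℂ :=
  fun a b => ∑ s, Rmat p γ x₁ t (a.1, r) (b.1, s) *
    Rmat p γ x₂ (t - γ * hWeight b.1) (a.2, s) (b.2, c)

lemma siteWeight_flip {p : ℝ} (hp0 : 0 < p) (γ x₁ x₂ t : ℂ) (r c a₁ a₂ b₁ b₂ : Fin 2) :
    siteWeight p γ x₁ x₂ t (flip r) (flip c) (flip a₁, flip a₂) (flip b₁, flip b₂) =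
      siteWeight p γ x₁ x₂ (-t) r c (a₁, a₂) (b₁, b₂) := by
  unfold siteWeight
  rw [← flipEquiv.sum_comp]
  refine Finset.sum_congr rfl fun s _ => ?_
  change Rmat p γ x₁ t (flip a₁, flip r) (flip b₁, flip s) *
    Rmat p γ x₂ (t - γ * hWeight (flip b₁)) (flip a₂, flip s) (flip b₂, flip c) = _
  rw [Rmat_flip hp0, Rmat_flip hp0, hWeight_flip]
  congr 2
  ring

-- The outgoing site label is `0`, so the left `R`-matrix is taken at `t - γ`. Entries other than
-- `e1`–`e9` are trivial or follow from commutativity.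
set_option maxHeartbeats 400000 in
lemma dynamicalYangBaxter_zero {p : ℝ} (hp0 : 0 < p) (hp1 : p < 1) (γ t u v : ℂ)
    (h0 : theta p t ≠ 0) (h1 : theta p (t - γ) ≠ 0) (h2 : theta p (t + γ) ≠ 0)
    (c : Fin 2) (a b : Fin 2 × Fin 2) :
    ∑ e, Rmat p γ u (t - γ) a e * siteWeight p γ (u + v) v t 0 c e b =
      ∑ e, siteWeight p γ v (u + v) t 0 c a.swap e.swap * Rmat p γ u t e b := by
  have e1 := dynamicalYangBaxter_cPlus_bMinus_a hp0 hp1 γ t u v h0 h1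
  have e2 := dynamicalYangBaxter_a_bMinus_cMinus hp0 hp1 γ t u v h0 h1
  have e3 := dynamicalYangBaxter_cMinus_bPlus_a hp0 hp1 γ t u v h0 h1
  have e4 := dynamicalYangBaxter_a_cMinus_a_left hp0 hp1 γ t u v h0 h1
  have e5 := dynamicalYangBaxter_a_cMinus_a_right hp0 hp1 γ t u v h0 h2
  have e6 := dynamicalYangBaxter_a_bMinus_cMinus_shift hp0 hp1 γ t u v h0 h2
  have e7 := dynamicalYangBaxter_b_a_b_c_c_c hp0 hp1 γ t u v h0 h1
  have e8 : wbMinus p γ u (t - γ) * wbMinus p γ (u + v) t * wa p γ v =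
      wa p γ v * wbMinus p γ (u + v) (t - γ) * wbMinus p γ u t := by
    simp only [wbMinus]; ring
  have e9 : wa p γ u * wbMinus p γ (u + v) t * wbMinus p γ v (t + γ) =
      wbMinus p γ v t * wbMinus p γ (u + v) (t + γ) * wa p γ u := by
    simp only [wbMinus]; ring
  obtain ⟨a₁, a₂⟩ := a
  obtain ⟨b₁, b₂⟩ := b
  have w0 : hWeight 0 = 1 := rfl
  have w1 : hWeight 1 = -1 := rfl
  fin_cases c <;> fin_cases a₁ <;> fin_cases a₂ <;> fin_cases b₁ <;> fin_cases b₂ <;>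
    simp only [Fintype.sum_prod_type, siteWeight, Fin.sum_univ_two, w0, w1, Rmat_entries,
      Prod.swap_prod_mk, Fin.zero_eta, Fin.mk_one, Fin.isValue, mul_zero, zero_mul, add_zero,
      zero_add, mul_one, mul_neg, sub_neg_eq_add, ← mul_assoc]
  all_goals first
    | exact e1
    | exact e2
    | exact e3
    | exact e4
    | exact e5
    | exact e6
    | exact e7
    | exact e8
    | exact e9
    | ring

/-- The dynamical Yang–Baxter equation. -/
lemma dynamicalYangBaxter {p : ℝ} (hp0 : 0 < p) (hp1 : p < 1) (γ t x₁ x₂ : ℂ)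
    (h0 : theta p t ≠ 0) (h1 : theta p (t - γ) ≠ 0) (h2 : theta p (t + γ) ≠ 0)
    (r c : Fin 2) :
    Rmat p γ (x₁ - x₂) (t - γ * hWeight r) * siteWeight p γ x₁ x₂ t r c =
      (siteWeight p γ x₂ x₁ t r c).submatrix Prod.swap Prod.swap * Rmat p γ (x₁ - x₂) t := by
  ext ⟨a₁, a₂⟩ ⟨b₁, b₂⟩
  simp only [Matrix.mul_apply, Matrix.submatrix_apply]
  obtain rfl | rfl : r = 0 ∨ r = 1 := by fin_cases r <;> simp
  · have h := dynamicalYangBaxter_zero hp0 hp1 γ t (x₁ - x₂) x₂ h0 h1 h2 c (a₁, a₂) (b₁, b₂)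
    rw [sub_add_cancel] at h
    simpa [hWeight] using h
  -- Flipping all labels turns outgoing label `1` at `t` into outgoing label `0` at `-t`; oddness
  -- carries the nonvanishing conditions over, with `t + γ` and `t - γ` exchanged.
  · have h := dynamicalYangBaxter_zero hp0 hp1 γ (-t) (x₁ - x₂) x₂
      (by rwa [theta_neg hp0, neg_ne_zero])
      (by rwa [show -t - γ = -(t + γ) by ring, theta_neg hp0, neg_ne_zero])
      (by rwa [show -t + γ = -(t - γ) by ring, theta_neg hp0, neg_ne_zero])
      (flip c) (flip a₁, flip a₂) (flip b₁, flip b₂)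
    rw [sub_add_cancel] at h
    refine Eq.trans ?_ (h.trans ?_)
    · refine Fintype.sum_equiv (flipEquiv.prodCongr flipEquiv) _ _ fun ⟨e₁, e₂⟩ => ?_
      change _ = Rmat p γ (x₁ - x₂) (-t - γ) (flip a₁, flip a₂) (flip e₁, flip e₂) *
        siteWeight p γ x₁ x₂ (-t) (flip 1) (flip c) (flip e₁, flip e₂) (flip b₁, flip b₂)
      rw [Rmat_flip hp0, siteWeight_flip hp0]
      simp [hWeight, add_comm]
    · refine (Fintype.sum_equiv (flipEquiv.prodCongr flipEquiv) _ _ fun ⟨e₁, e₂⟩ => ?_).symm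
      change _ = siteWeight p γ x₂ x₁ (-t) (flip 1) (flip c) (flip a₂, flip a₁)
        (flip e₂, flip e₁) * Rmat p γ (x₁ - x₂) (-t) (flip e₁, flip e₂) (flip b₁, flip b₂)
      rw [Rmat_flip hp0, siteWeight_flip hp0]
      simp

/-! ### The monodromy matrix: recursion over sites and exchange relation -/

/-- The total weight of a configuration. -/
def totalWeight {L : ℕ} (c : Config L) : ℂ := ∑ k, hWeight (c k)

lemma totalWeight_cons {L : ℕ} (c₀ : Fin 2) (c : Config L) :
    totalWeight (Fin.cons c₀ c : Config (L + 1)) = hWeight c₀ + totalWeight c := by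
  simp [totalWeight, Fin.sum_univ_succ]

lemma sum_config_succ {L : ℕ} (f : Config (L + 1) → ℂ) :
    ∑ s, f s = ∑ s₀, ∑ s : Config L, f (Fin.cons s₀ s) := by
  rw [← Fintype.sum_prod_type', ← (Fin.consEquiv fun _ => Fin 2).sum_comp]
  rfl

lemma R0_zero_cons {L : ℕ} (p : ℝ) (γ x t : ℂ) (a b r₀ c₀ : Fin 2) (r c : Config L) :
    R0 p γ (0 : Fin (L + 1)) x t (a, Fin.cons r₀ r) (b, Fin.cons c₀ c) =
      if r = c then Rmat p γ x (t - γ * totalWeight c) (a, r₀) (b, c₀) else 0 := by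
  have h : (∀ k : Fin (L + 1), k ≠ 0 → (Fin.cons r₀ r : Config (L + 1)) k =
      (Fin.cons c₀ c : Config (L + 1)) k) ↔ r = c := by
    rw [Fin.forall_fin_succ]
    simp [funext_iff]
  have hs : ∑ k ∈ Finset.univ.filter (fun k : Fin (L + 1) => 0 < k),
      hWeight ((Fin.cons c₀ c : Config (L + 1)) k) = totalWeight c := by
    rw [Finset.sum_filter, Fin.sum_univ_succ]
    simp [totalWeight]
  simp only [R0, h, hs, Fin.cons_zero]

lemma R0_succ_cons {L : ℕ} (p : ℝ) (γ x t : ℂ) (i : Fin L) (a b r₀ c₀ : Fin 2)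
    (r c : Config L) :
    R0 p γ i.succ x t (a, Fin.cons r₀ r) (b, Fin.cons c₀ c) =
      if r₀ = c₀ then R0 p γ i x t (a, r) (b, c) else 0 := by
  have h : (∀ k : Fin (L + 1), k ≠ i.succ → (Fin.cons r₀ r : Config (L + 1)) k =
      (Fin.cons c₀ c : Config (L + 1)) k) ↔ r₀ = c₀ ∧ ∀ k, k ≠ i → r k = c k := by
    rw [Fin.forall_fin_succ]
    simp [(Fin.succ_ne_zero i).symm]
  have hs : ∑ k ∈ Finset.univ.filter (fun k : Fin (L + 1) => i.succ < k),
      hWeight ((Fin.cons c₀ c : Config (L + 1)) k) =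
      ∑ k ∈ Finset.univ.filter (fun k : Fin L => i < k), hWeight (c k) := by
    rw [Finset.sum_filter, Finset.sum_filter, Fin.sum_univ_succ]
    simp
  simp only [R0, h, hs, Fin.cons_succ]
  split_ifs <;> tauto

lemma prod_R0_succ_cons {L : ℕ} (p : ℝ) (γ t : ℂ) (x : Fin L → ℂ) (l : List (Fin L))
    (a b r₀ c₀ : Fin 2) (r c : Config L) :
    (l.map fun i => R0 p γ i.succ (x i) t).prod (a, Fin.cons r₀ r) (b, Fin.cons c₀ c) =
      if r₀ = c₀ then (l.map fun i => R0 p γ i (x i) t).prod (a, r) (b, c) else 0 := by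
  induction l generalizing a r₀ r with
  | nil =>
    simp only [List.map_nil, List.prod_nil, Matrix.one_apply, Prod.mk.injEq, Fin.cons_inj]
    split_ifs <;> tauto
  | cons i l ih =>
    simp only [List.map_cons, List.prod_cons, Matrix.mul_apply, Fintype.sum_prod_type,
      sum_config_succ, R0_succ_cons, ih]
    split_ifs with h
    · subst h
      simp
    · refine Finset.sum_eq_zero fun d _ => Finset.sum_eq_zero fun s₀ _ =>
        Finset.sum_eq_zero fun s _ => ?_
      split_ifs with h1 h2
      · exact absurd (h1.trans h2) h
      all_goals simp

/-- The leftmost factor fixes all sites but the first, so its dynamical shift is the weight of the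
outgoing configuration `r` of the others; the remaining factors neither move nor see the first site.
-/
lemma monodromy_cons {L : ℕ} (p : ℝ) (γ : ℂ) (μ : Fin (L + 1) → ℂ) (x t : ℂ)
    (a b r₀ c₀ : Fin 2) (r c : Config L) :
    monodromy p γ μ x t (a, Fin.cons r₀ r) (b, Fin.cons c₀ c) =
      ∑ d, Rmat p γ (x - μ 0) (t - γ * totalWeight r) (a, r₀) (d, c₀) *
        monodromy p γ (Fin.tail μ) x t (d, r) (b, c) := by
  have h1 : monodromy p γ μ x t = R0 p γ 0 (x - μ 0) t *
      ((List.finRange L).map fun i => R0 p γ i.succ (x - μ i.succ) t).prod := by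
    rw [monodromy, List.ofFn_succ, List.prod_cons, List.ofFn_eq_map]
  have h2 : monodromy p γ (Fin.tail μ) x t =
      ((List.finRange L).map fun i => R0 p γ i (x - μ i.succ) t).prod := by
    rw [monodromy, List.ofFn_eq_map]
    rfl
  rw [h1, h2]
  simp only [Matrix.mul_apply, Fintype.sum_prod_type, sum_config_succ, R0_zero_cons,
    prod_R0_succ_cons p γ t fun i => x - μ i.succ]
  simp

lemma monodromy_zero (p : ℝ) (γ : ℂ) (μ : Fin 0 → ℂ) (x t : ℂ) : monodromy p γ μ x t = 1 := by
  simp [monodromy]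

lemma Rmat_eq_zero {p : ℝ} {γ x t : ℂ} {a b c d : Fin 2}
    (h : hWeight a + hWeight b ≠ hWeight c + hWeight d) :
    Rmat p γ x t (a, b) (c, d) = 0 := by
  have w0 : hWeight 0 = 1 := rfl
  have w1 : hWeight 1 = -1 := rfl
  fin_cases a <;> fin_cases b <;> fin_cases c <;> fin_cases d <;>
    simp [w0, w1] at h <;> rfl

/-- Weight conservation. -/
lemma monodromy_eq_zero {L : ℕ} {p : ℝ} {γ : ℂ} {μ : Fin L → ℂ} {x t : ℂ} {a b : Fin 2}
    {r c : Config L} (h : hWeight a + totalWeight r ≠ hWeight b + totalWeight c) :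
    monodromy p γ μ x t (a, r) (b, c) = 0 := by
  induction L generalizing a with
  | zero =>
    rw [monodromy_zero, Matrix.one_apply_ne]
    rintro h'
    simp only [Prod.mk.injEq] at h'
    exact h (by rw [h'.1, h'.2])
  | succ L ih =>
    induction r using Fin.consCases with | _ r₀ r
    induction c using Fin.consCases with | _ c₀ c
    rw [monodromy_cons]
    refine Finset.sum_eq_zero fun d _ => ?_
    by_cases h1 : hWeight a + hWeight r₀ = hWeight d + hWeight c₀
    · rw [ih, mul_zero]
      intro h2
      simp only [totalWeight_cons] at h
      exact h (by linear_combination h1 + h2)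
    · rw [Rmat_eq_zero h1, zero_mul]

/-- The product of two monodromy matrices with fixed configurations of the sites, as a matrix
in the auxiliary labels. -/
def monodromyPair {L : ℕ} (p : ℝ) (γ : ℂ) (μ : Fin L → ℂ) (x₁ x₂ t : ℂ) (r c : Config L) :
    Matrix (Fin 2 × Fin 2) (Fin 2 × Fin 2) ℂ :=
  fun a b => ∑ s, monodromy p γ μ x₁ t (a.1, r) (b.1, s) *
    monodromy p γ μ x₂ (t - γ * hWeight b.1) (a.2, s) (b.2, c)

lemma monodromyPair_cons {L : ℕ} (p : ℝ) (γ : ℂ) (μ : Fin (L + 1) → ℂ) (x₁ x₂ t : ℂ)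
    (r₀ c₀ : Fin 2) (r c : Config L) :
    monodromyPair p γ μ x₁ x₂ t (Fin.cons r₀ r) (Fin.cons c₀ c) =
      siteWeight p γ (x₁ - μ 0) (x₂ - μ 0) (t - γ * totalWeight r) r₀ c₀ *
        monodromyPair p γ (Fin.tail μ) x₁ x₂ t r c := by
  ext ⟨a₁, a₂⟩ ⟨b₁, b₂⟩
  -- Weight conservation trades the shift by the intermediate configuration `s` and `b₁` for one by
  -- `r` and `d`. The first site's argument then no longer depends on `s`, and the sums factorise.
  have key (s : Config L) (d : Fin 2) (f : ℂ → ℂ) :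
      f (t - γ * hWeight b₁ - γ * totalWeight s) *
          monodromy p γ (Fin.tail μ) x₁ t (d, r) (b₁, s) =
        f (t - γ * totalWeight r - γ * hWeight d) *
          monodromy p γ (Fin.tail μ) x₁ t (d, r) (b₁, s) := by
    by_cases h : hWeight d + totalWeight r = hWeight b₁ + totalWeight s
    · rw [show t - γ * hWeight b₁ - γ * totalWeight s = t - γ * totalWeight r - γ * hWeight d by
        linear_combination γ * h]
    · rw [monodromy_eq_zero h, mul_zero, mul_zero]
  simp only [monodromyPair, siteWeight, Matrix.mul_apply, sum_config_succ, monodromy_cons,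
    Fintype.sum_prod_type, Finset.sum_mul_sum]
  have e (s₀ : Fin 2) (s : Config L) (d₁ d₂ : Fin 2) :
      Rmat p γ (x₁ - μ 0) (t - γ * totalWeight r) (a₁, r₀) (d₁, s₀) *
          monodromy p γ (Fin.tail μ) x₁ t (d₁, r) (b₁, s) *
        (Rmat p γ (x₂ - μ 0) (t - γ * hWeight b₁ - γ * totalWeight s) (a₂, s₀) (d₂, c₀) *
          monodromy p γ (Fin.tail μ) x₂ (t - γ * hWeight b₁) (d₂, s) (b₂, c)) =
      Rmat p γ (x₁ - μ 0) (t - γ * totalWeight r) (a₁, r₀) (d₁, s₀) *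
          Rmat p γ (x₂ - μ 0) (t - γ * totalWeight r - γ * hWeight d₁) (a₂, s₀) (d₂, c₀) *
        (monodromy p γ (Fin.tail μ) x₁ t (d₁, r) (b₁, s) *
          monodromy p γ (Fin.tail μ) x₂ (t - γ * hWeight b₁) (d₂, s) (b₂, c)) := by
    linear_combination Rmat p γ (x₁ - μ 0) (t - γ * totalWeight r) (a₁, r₀) (d₁, s₀) *
      monodromy p γ (Fin.tail μ) x₂ (t - γ * hWeight b₁) (d₂, s) (b₂, c) *
      key s d₁ fun z => Rmat p γ (x₂ - μ 0) z (a₂, s₀) (d₂, c₀)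
  simp only [e]
  simp only [Fin.sum_univ_two, Finset.sum_add_distrib]
  ring

/-- The exchange relation of the dynamical Yang–Baxter algebra. -/
lemma monodromy_exchange {L : ℕ} {p : ℝ} (hp0 : 0 < p) (hp1 : p < 1) (γ : ℂ) (μ : Fin L → ℂ)
    (x₁ x₂ t : ℂ) (ht : ∀ n : ℤ, theta p (t + n * γ) ≠ 0) (r c : Config L) :
    Rmat p γ (x₁ - x₂) (t - γ * totalWeight r) * monodromyPair p γ μ x₁ x₂ t r c =
      (monodromyPair p γ μ x₂ x₁ t r c).submatrix Prod.swap Prod.swap *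
        Rmat p γ (x₁ - x₂) t := by
  -- All shifts are integer multiples of `γ`, so genericity of `t` covers every denominator met in
  -- the induction.
  have hw {L : ℕ} (r : Config L) : ∃ n : ℤ, totalWeight r = n := by
    refine ⟨∑ k, (![1, -1] : Fin 2 → ℤ) (r k), ?_⟩
    rw [totalWeight, Int.cast_sum]
    refine Finset.sum_congr rfl fun k _ => ?_
    generalize r k = a
    fin_cases a <;> simp [hWeight]
  induction L with
  | zero =>
    have h1 (x y : ℂ) : monodromyPair p γ μ x y t r c = 1 := by
      ext ⟨a₁, a₂⟩ ⟨b₁, b₂⟩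
      simp only [monodromyPair, monodromy_zero]
      simp [Matrix.one_apply, Subsingleton.elim _ c, ite_and, and_comm]
      split_ifs <;> rfl
    rw [h1, h1]
    have h2 : totalWeight r = 0 := by simp [totalWeight]
    rw [h2]
    have h3 := Matrix.submatrix_one_equiv (α := ℂ) (Equiv.prodComm (Fin 2) (Fin 2))
    rw [Equiv.coe_prodComm] at h3
    simp [h3]
  | succ L ih =>
    induction r using Fin.consCases with | _ r₀ r
    induction c using Fin.consCases with | _ c₀ c
    obtain ⟨n, hn⟩ := hw r
    -- This moves the `R`-matrix past the first site and leaves it at the argument required by the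
    -- induction hypothesis for the remaining sites.
    have hd := dynamicalYangBaxter hp0 hp1 γ (t - γ * totalWeight r) (x₁ - μ 0) (x₂ - μ 0)
      (by convert ht (-n) using 2; rw [hn]; push_cast; ring)
      (by convert ht (-n - 1) using 2; rw [hn]; push_cast; ring)
      (by convert ht (-n + 1) using 2; rw [hn]; push_cast; ring) r₀ c₀
    rw [sub_sub_sub_cancel_right] at hd
    rw [monodromyPair_cons, monodromyPair_cons, totalWeight_cons, ← Matrix.mul_assoc,
      show t - γ * (hWeight r₀ + totalWeight r) = t - γ * totalWeight r - γ * hWeight r₀ by ring,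
      hd, Matrix.mul_assoc, ih (Fin.tail μ) r c, ← Matrix.mul_assoc]
    congr 1
    exact (Matrix.submatrix_mul_equiv _ _ _ (Equiv.prodComm (Fin 2) (Fin 2)) _)

/-! ### Density of generic arguments and continuity in the spectral parameter -/

/-- The zeros of a holomorphic function that is not identically zero form a closed discrete set, and
such a set is countable in the Lindelöf space `ℂ`. -/
lemma countable_theta_eq_zero {p : ℝ} (hp0 : 0 < p) (hp1 : p < 1) {z : ℂ} (hz : theta p z ≠ 0) :
    {x | theta p x = 0}.Countable := by
  have h1 : AnalyticOnNhd ℂ (theta p) Set.univ := fun x _ =>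
    (differentiable_theta hp0 hp1).analyticAt x
  have h2 := h1.preimage_zero_mem_codiscrete hz
  have h3 : ({x | theta p x = 0}ᶜ : Set ℂ) ∈ Filter.codiscrete ℂ := h2
  have h4 := (HereditarilyLindelofSpace.isLindelof _).countable_of_isDiscrete
    (isDiscrete_of_codiscreteWithin (U := Set.univ) h3)
  simpa using h4

/-- Countably many translates of a countable set are avoided at once. This serves both to remove a
factor `[x₁-x₂+γ]` and to choose `τ` avoiding all integer shifts. -/
lemma dense_theta_shift_ne_zero {p : ℝ} (hp0 : 0 < p) (hp1 : p < 1) {z : ℂ}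
    (hz : theta p z ≠ 0) {ι : Type*} [Countable ι] (f : ι → ℂ) :
    Dense {x | ∀ i, theta p (x + f i) ≠ 0} := by
  have h : (⋃ i, (fun x => x + f i) ⁻¹' {x | theta p x = 0}).Countable :=
    Set.countable_iUnion fun i =>
      (countable_theta_eq_zero hp0 hp1 hz).preimage (add_left_injective (f i))
  convert h.dense_compl ℝ using 1
  ext x
  simp

lemma continuous_Rmat {p : ℝ} (hp0 : 0 < p) (hp1 : p < 1) (γ t : ℂ) (a b : Fin 2 × Fin 2) :
    Continuous fun x => Rmat p γ x t a b := by
  have h := continuous_theta hp0 hp1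
  obtain ⟨a₁, a₂⟩ := a
  obtain ⟨b₁, b₂⟩ := b
  fin_cases a₁ <;> fin_cases a₂ <;> fin_cases b₁ <;> fin_cases b₂ <;>
    simp only [Fin.zero_eta, Fin.mk_one, Fin.isValue, Rmat_entries, wa, wbPlus, wbMinus, wcPlus,
      wcMinus] <;> fun_prop

lemma continuous_monodromy {p : ℝ} (hp0 : 0 < p) (hp1 : p < 1) {L : ℕ} (γ : ℂ) (μ : Fin L → ℂ)
    (t : ℂ) (a b : Fin 2) (r c : Config L) :
    Continuous fun x => monodromy p γ μ x t (a, r) (b, c) := by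
  induction L generalizing a with
  | zero =>
    simp only [monodromy_zero]
    exact continuous_const
  | succ L ih =>
    induction r using Fin.consCases with | _ r₀ r
    induction c using Fin.consCases with | _ c₀ c
    simp only [monodromy_cons]
    refine continuous_finsetSum _ fun d _ => ?_
    exact ((continuous_Rmat hp0 hp1 γ _ _ _).comp (continuous_id.sub continuous_const)).mul
      (ih _ _ _ _)

/-! ### Commutation relations of `B` and `D` -/

/-- The operator `D(x, τ)` on `(ℂ²)^{⊗ L}`: the lower right block of the monodromy matrix. -/
def opD {L : ℕ} (p : ℝ) (γ : ℂ) (μ : Fin L → ℂ) (x τ : ℂ) :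
    Matrix (Config L) (Config L) ℂ :=
  fun r c => monodromy p γ μ x τ (1, r) (1, c)

lemma opB_eq_zero {L : ℕ} {p : ℝ} {γ : ℂ} {μ : Fin L → ℂ} {x t : ℂ} {r c : Config L}
    (h : totalWeight r + 2 ≠ totalWeight c) : opB p γ μ x t r c = 0 := by
  refine monodromy_eq_zero fun h' => h ?_
  simp only [hWeight, Matrix.cons_val_zero, Matrix.cons_val_one] at h'
  linear_combination h'

lemma opD_eq_zero {L : ℕ} {p : ℝ} {γ : ℂ} {μ : Fin L → ℂ} {x t : ℂ} {r c : Config L}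
    (h : totalWeight r ≠ totalWeight c) : opD p γ μ x t r c = 0 :=
  monodromy_eq_zero fun h' => h (add_left_cancel h')

/-- In the row `(0,0)` and column `(1,1)` of the exchange relation both `R`-matrices reduce to the
same scalar `[x₁-x₂+γ]`, which is cancelled. -/
lemma opB_mul_opB_of_ne {L : ℕ} {p : ℝ} (hp0 : 0 < p) (hp1 : p < 1) {γ : ℂ} {μ : Fin L → ℂ}
    {x₁ x₂ t : ℂ} (ht : ∀ n : ℤ, theta p (t + n * γ) ≠ 0) (h : theta p (x₁ - x₂ + γ) ≠ 0) :
    opB p γ μ x₁ t * opB p γ μ x₂ (t + γ) = opB p γ μ x₂ t * opB p γ μ x₁ (t + γ) := by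
  ext r c
  have e := congrFun₂ (monodromy_exchange hp0 hp1 γ μ x₁ x₂ t ht r c) (0, 0) (1, 1)
  simp only [Matrix.mul_apply, Fintype.sum_prod_type, Fin.sum_univ_two, Rmat_entries,
    Matrix.submatrix_apply, monodromyPair, Prod.swap_prod_mk, wa, hWeight, Matrix.cons_val_zero,
    Matrix.cons_val_one, mul_neg, mul_one, sub_neg_eq_add, zero_mul, mul_zero, add_zero,
    zero_add, Fin.isValue] at e
  simp only [Matrix.mul_apply, opB]
  exact mul_left_cancel₀ h (e.trans (mul_comm _ _))

/-- Both sides are continuous in `x₁`, and the factor cancelled above is nonzero on a dense set. -/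
lemma opB_mul_opB {L : ℕ} {p : ℝ} (hp0 : 0 < p) (hp1 : p < 1) {γ : ℂ} {μ : Fin L → ℂ}
    {t : ℂ} (ht : ∀ n : ℤ, theta p (t + n * γ) ≠ 0) (x₁ x₂ : ℂ) :
    opB p γ μ x₁ t * opB p γ μ x₂ (t + γ) = opB p γ μ x₂ t * opB p γ μ x₁ (t + γ) := by
  ext r c
  have hB (t : ℂ) (r c : Config L) : Continuous fun x => opB p γ μ x t r c :=
    continuous_monodromy hp0 hp1 γ μ t 0 1 r c
  have hd := dense_theta_shift_ne_zero hp0 hp1 (ht 0) fun _ : Unit => -x₂ + γ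
  refine congrFun (Continuous.ext_on hd
    (f := fun x₁ => (opB p γ μ x₁ t * opB p γ μ x₂ (t + γ)) r c)
    (g := fun x₁ => (opB p γ μ x₂ t * opB p γ μ x₁ (t + γ)) r c) ?_ ?_ ?_) x₁
  · simp only [Matrix.mul_apply]
    exact continuous_finsetSum _ fun s _ => (hB _ _ _).mul continuous_const
  · simp only [Matrix.mul_apply]
    exact continuous_finsetSum _ fun s _ => continuous_const.mul (hB _ _ _)
  · intro x hx
    have := opB_mul_opB_of_ne hp0 hp1 (μ := μ) (x₁ := x) (x₂ := x₂) ht (by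
      simpa [sub_eq_add_neg, add_assoc] using hx ())
    exact congrFun₂ this r c

lemma opD_mul_opB {L : ℕ} {p : ℝ} (hp0 : 0 < p) (hp1 : p < 1) {γ : ℂ} {μ : Fin L → ℂ}
    {t : ℂ} (ht : ∀ n : ℤ, theta p (t + n * γ) ≠ 0) (x₁ x₂ : ℂ) (r c : Config L) :
    wbMinus p γ (x₁ - x₂) (t - γ * totalWeight r) *
          (opD p γ μ x₁ t * opB p γ μ x₂ (t + γ)) r c +
        wcMinus p γ (x₁ - x₂) (t - γ * totalWeight r) *
          (opB p γ μ x₁ t * opD p γ μ x₂ (t + γ)) r c =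
      theta p (x₁ - x₂ + γ) * (opB p γ μ x₂ t * opD p γ μ x₁ (t + γ)) r c := by
  have e := congrFun₂ (monodromy_exchange hp0 hp1 γ μ x₁ x₂ t ht r c) (1, 0) (1, 1)
  simp only [Matrix.mul_apply, Fintype.sum_prod_type, Fin.sum_univ_two, Rmat_entries,
    Matrix.submatrix_apply, monodromyPair, Prod.swap_prod_mk, wa, hWeight, Matrix.cons_val_zero,
    Matrix.cons_val_one, mul_neg, mul_one, sub_neg_eq_add, zero_mul, mul_zero, add_zero,
    zero_add, Fin.isValue] at e
  simp only [Matrix.mul_apply, opB, opD]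
  linear_combination e

/-! ### Bethe vectors and the reference states -/

/-- The reference state `v₁^{⊗ L}`. -/
def vacuum (L : ℕ) : Config L → ℂ := Pi.single (fun _ => 0) 1

/-- The vector `B(x_1, t) B(x_2, t + γ) ⋯ B(x_n, t + (n - 1) γ) |0⟩`. -/
def betheVector {L : ℕ} (p : ℝ) (γ : ℂ) (μ : Fin L → ℂ) : List ℂ → ℂ → Config L → ℂ
  | [], _ => vacuum L
  | x :: l, t => (opB p γ μ x t).mulVec (betheVector p γ μ l (t + γ))

lemma generic_add {p : ℝ} {γ t : ℂ} (ht : ∀ n : ℤ, theta p (t + n * γ) ≠ 0) (n : ℤ) :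
    theta p (t + γ + n * γ) ≠ 0 := by
  convert ht (n + 1) using 2
  push_cast
  ring

/-- An adjacent swap is the commutation of two `B`'s at arguments `t` and `t + γ`, as they occur in
the product. Bethe vectors may therefore be indexed by finite sets. -/
lemma betheVector_perm {L : ℕ} {p : ℝ} (hp0 : 0 < p) (hp1 : p < 1) {γ : ℂ} {μ : Fin L → ℂ}
    {l l' : List ℂ} (h : l.Perm l') {t : ℂ} (ht : ∀ n : ℤ, theta p (t + n * γ) ≠ 0) :
    betheVector p γ μ l t = betheVector p γ μ l' t := by
  induction h generalizing t with
  | nil => rfl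
  | cons x _ ih => simp only [betheVector, ih (generic_add ht)]
  | swap x y l =>
    simp only [betheVector, Matrix.mulVec_mulVec, opB_mul_opB hp0 hp1 ht x y]
  | trans _ _ ih1 ih2 => rw [ih1 ht, ih2 ht]

lemma totalWeight_zero (L : ℕ) : totalWeight (fun _ : Fin L => 0) = L := by
  simp [totalWeight, hWeight]

/-- Each `B` lowers the total weight by `2`, starting from weight `L`. -/
lemma betheVector_eq_zero {L : ℕ} {p : ℝ} {γ : ℂ} {μ : Fin L → ℂ} {l : List ℂ} {t : ℂ}
    {c : Config L} (h : totalWeight c ≠ L - 2 * l.length) : betheVector p γ μ l t c = 0 := by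
  induction l generalizing t c with
  | nil =>
    rw [betheVector, vacuum, Pi.single_eq_of_ne]
    rintro rfl
    simp [totalWeight_zero] at h
  | cons x l ih =>
    rw [betheVector, Matrix.mulVec, dotProduct]
    refine Finset.sum_eq_zero fun s _ => ?_
    by_cases hs : totalWeight s = L - 2 * l.length
    · rw [opB_eq_zero, zero_mul]
      intro h'
      rw [List.length_cons] at h
      push_cast at h
      exact h (by linear_combination h' + hs)
    · rw [ih hs, mul_zero]

lemma Z_eq_betheVector {L : ℕ} (p : ℝ) (γ : ℂ) (μ : Fin L → ℂ) (τ : ℂ) (x : Fin L → ℂ) :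
    Z p γ μ τ x = betheVector p γ μ (List.ofFn x) (τ + γ) (fun _ => 1) := by
  have key (n : ℕ) (x : Fin n → ℂ) (t : ℂ) :
      (List.ofFn fun j : Fin n => opB p γ μ (x j) (t + (j : ℕ) * γ)).prod.mulVec (vacuum L) =
        betheVector p γ μ (List.ofFn x) t := by
    induction n generalizing t with
    | zero => simp [betheVector]
    | succ n ih =>
      rw [List.ofFn_succ, List.ofFn_succ, List.prod_cons, betheVector, ← Matrix.mulVec_mulVec,
        ← ih]
      simp only [Fin.val_zero, Fin.val_succ, Nat.cast_zero, zero_mul, add_zero, Nat.cast_add,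
        Nat.cast_one, add_mul, one_mul, add_assoc, add_comm γ]
  rw [← key, vacuum, Matrix.mulVec_single_one, Z]
  simp only [add_mul, one_mul, add_assoc, add_comm γ]
  rfl

/-- On the reference state only the weights `b_-` contribute, at arguments `t, t - γ, …, t -
(L-1)γ`; their dynamical factors telescope to the quotient in front. -/
lemma opD_mulVec_vacuum {L : ℕ} {p : ℝ} {γ : ℂ} (μ : Fin L → ℂ) (x : ℂ) {t : ℂ}
    (ht : ∀ n : ℤ, theta p (t + n * γ) ≠ 0) :
    (opD p γ μ x t).mulVec (vacuum L) =
      (theta p (t + γ) / theta p (t - L * γ + γ) * ∏ k, theta p (x - μ k)) • vacuum L := by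
  have key (r : Config L) : opD p γ μ x t r (fun _ => 0) =
      if r = fun _ => 0 then
        theta p (t + γ) / theta p (t - L * γ + γ) * ∏ k, theta p (x - μ k) else 0 := by
    induction L with
    | zero =>
      have h : theta p (t + γ) ≠ 0 := by simpa using ht 1
      simp [opD, monodromy_zero, Subsingleton.elim r fun _ => 0, h]
    | succ L ih =>
      induction r using Fin.consCases with | _ r₀ r
      have hz : (fun _ => 0 : Config (L + 1)) = Fin.cons 0 fun _ => 0 := by
        ext k; cases k using Fin.cases <;> rfl
      have hw : t - γ * totalWeight (fun _ : Fin L => 0) = t - L * γ := by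
        rw [totalWeight_zero, mul_comm]
      have h0 : theta p (t - L * γ) ≠ 0 := by
        convert ht (-L) using 2; push_cast; ring
      have h1 : theta p (t - L * γ + γ) ≠ 0 := by
        convert ht (-L + 1) using 2; push_cast; ring
      have h2 : t - ((L + 1 : ℕ) : ℂ) * γ + γ = t - L * γ := by push_cast; ring
      have ih' := ih (Fin.tail μ) r
      rw [opD] at ih' ⊢
      rw [hz, monodromy_cons, Fin.sum_univ_two, ih', Fin.prod_univ_succ, h2]
      simp only [Fin.cons_inj]
      have hr : r₀ = 0 ∨ r₀ = 1 := by fin_cases r₀ <;> simp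
      by_cases hr' : r = fun _ => 0
      · subst hr'
        rcases hr with rfl | rfl
        · rw [hw]
          simp only [Rmat_entries, wbMinus, zero_mul, zero_add, and_self, if_true]
          simp only [Fin.tail]
          field_simp
        · simp [Rmat_entries]
      · rcases hr with rfl | rfl <;> simp [Rmat_entries, hr']
  ext r
  simp only [vacuum, Matrix.mulVec_single_one, Matrix.col_apply, key, Pi.smul_apply,
    Pi.single_apply, smul_eq_mul, mul_ite, mul_one, mul_zero]

/-- With outgoing auxiliary label and all outgoing sites equal to `1`, only the weight `a_-` is
available at each site, so no dynamical factor appears. -/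
lemma opD_dualVacuum {L : ℕ} (p : ℝ) (γ : ℂ) (μ : Fin L → ℂ) (x t : ℂ) (c : Config L) :
    opD p γ μ x t (fun _ => 1) c =
      if c = fun _ => 1 then ∏ k, theta p (x - μ k + γ) else 0 := by
  induction L with
  | zero => simp [opD, monodromy_zero, Subsingleton.elim c fun _ => 1]
  | succ L ih =>
    induction c using Fin.consCases with | _ c₀ c
    have hz : (fun _ => 1 : Config (L + 1)) = Fin.cons 1 fun _ => 1 := by
      ext k; cases k using Fin.cases <;> rfl
    have ih' := ih (Fin.tail μ) c
    rw [opD] at ih' ⊢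
    rw [hz, monodromy_cons, Fin.sum_univ_two, ih', Fin.prod_univ_succ]
    simp only [Fin.cons_inj]
    have hc : c₀ = 0 ∨ c₀ = 1 := by fin_cases c₀ <;> simp
    rcases hc with rfl | rfl
    · simp [Rmat_entries]
    · simp only [Rmat_entries, zero_mul, zero_add, true_and, wa, Fin.tail, mul_ite, mul_zero]

/-! ### The action of `D` on Bethe vectors -/

/-- The coefficient of the exchanged term in the commutation relation of `D` and `B`. -/
def exchangeCoeff (p : ℝ) (γ u T : ℂ) : ℂ := theta p γ * theta p (u + T) / (theta p T * theta p u)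

/-- Another instance of the three-term identity. It merges the two ways in which an exchange with a
given parameter arises when one more `B` is put in front. -/
lemma exchangeCoeff_relation {p : ℝ} (hp0 : 0 < p) (hp1 : p < 1) (γ u v T : ℂ)
    (hT : theta p T ≠ 0) (hT' : theta p (T - γ) ≠ 0) (hu : theta p u ≠ 0) (hv : theta p v ≠ 0)
    (huv : theta p (u + v) ≠ 0) :
    theta p (u + γ) / theta p u * exchangeCoeff p γ (u + v) (T - γ) =
      exchangeCoeff p γ u T * exchangeCoeff p γ v (T - γ) +
        exchangeCoeff p γ (u + v) T * (theta p (-v + γ) / theta p (-v)) := by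
  have h :
      theta p (u + γ) * theta p (u + v + T - γ) * (theta p T * theta p v) -
        theta p (u + v + T) * theta p u * (theta p (v - γ) * theta p (T - γ)) -
        theta p (u + T) * theta p (u + v) * (theta p γ * theta p (v + T - γ)) = 0 := by
    have hh := theta_three_term hp0 hp1 (1 / 2 * T + u + 1 / 2 * v)
      (-1 / 2 * T + γ - 1 / 2 * v) (1 / 2 * T + 1 / 2 * v) (1 / 2 * T - 1 / 2 * v)
    rw [show (1 / 2 * T + u + 1 / 2 * v) + (-1 / 2 * T + γ - 1 / 2 * v) = u + γ by ring,
      show (1 / 2 * T + u + 1 / 2 * v) - (-1 / 2 * T + γ - 1 / 2 * v) = u + v + T - γ by ring,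
      show (1 / 2 * T + 1 / 2 * v) + (1 / 2 * T - 1 / 2 * v) = T by ring,
      show (1 / 2 * T + 1 / 2 * v) - (1 / 2 * T - 1 / 2 * v) = v by ring,
      show (1 / 2 * T + u + 1 / 2 * v) + (1 / 2 * T + 1 / 2 * v) = u + v + T by ring,
      show (1 / 2 * T + u + 1 / 2 * v) - (1 / 2 * T + 1 / 2 * v) = u by ring,
      show (-1 / 2 * T + γ - 1 / 2 * v) + (1 / 2 * T - 1 / 2 * v) = -(v - γ) by ring,
      show (-1 / 2 * T + γ - 1 / 2 * v) - (1 / 2 * T - 1 / 2 * v) = -(T - γ) by ring,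
      show (1 / 2 * T + u + 1 / 2 * v) + (1 / 2 * T - 1 / 2 * v) = u + T by ring,
      show (1 / 2 * T + u + 1 / 2 * v) - (1 / 2 * T - 1 / 2 * v) = u + v by ring,
      show (-1 / 2 * T + γ - 1 / 2 * v) + (1 / 2 * T + 1 / 2 * v) = γ by ring,
      show (-1 / 2 * T + γ - 1 / 2 * v) - (1 / 2 * T + 1 / 2 * v) = -(v + T - γ) by ring,
      theta_neg hp0, theta_neg hp0, theta_neg hp0] at hh
    linear_combination hh
  rw [show -v + γ = -(v - γ) by ring, theta_neg hp0, theta_neg hp0]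
  unfold exchangeCoeff
  rw [show u + v + (T - γ) = u + v + T - γ by ring, show v + (T - γ) = v + T - γ by ring]
  field_simp
  linear_combination theta p γ * h

/-- The exchange relation has coefficients depending on the weight of the row. On a vector `ψ` of
definite weight only rows of weight `L - 2(n+1)` matter, so the coefficients become functions of the
number `T`. -/
lemma opD_mulVec_opB_mulVec {L : ℕ} {p : ℝ} (hp0 : 0 < p) (hp1 : p < 1) {γ : ℂ}
    {μ : Fin L → ℂ} {t : ℂ} (ht : ∀ n : ℤ, theta p (t + n * γ) ≠ 0) {x₁ x₂ : ℂ}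
    (hx : theta p (x₁ - x₂) ≠ 0) {ψ : Config L → ℂ} {n : ℕ}
    (hψ : ∀ c, totalWeight c ≠ L - 2 * n → ψ c = 0) {T : ℂ} (hT : T = t - γ * (L - 2 * (n + 1))) :
    (opD p γ μ x₁ t).mulVec ((opB p γ μ x₂ (t + γ)).mulVec ψ) =
      (theta p T / theta p (T + γ)) •
        ((theta p (x₁ - x₂ + γ) / theta p (x₁ - x₂)) •
            (opB p γ μ x₂ t).mulVec ((opD p γ μ x₁ (t + γ)).mulVec ψ) -
          exchangeCoeff p γ (x₁ - x₂) T •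
            (opB p γ μ x₁ t).mulVec ((opD p γ μ x₂ (t + γ)).mulVec ψ)) := by
  have hT0 : theta p T ≠ 0 := by
    convert ht (-L + 2 * (n + 1)) using 2; rw [hT]; push_cast; ring
  have hT1 : theta p (T + γ) ≠ 0 := by
    convert ht (-L + 2 * (n + 1) + 1) using 2; rw [hT]; push_cast; ring
  simp only [Matrix.mulVec_mulVec]
  ext r
  simp only [Pi.smul_apply, Pi.sub_apply, smul_eq_mul]
  by_cases hr : totalWeight r = L - 2 * (n + 1)
  · have e (c : Config L) := opD_mul_opB hp0 hp1 (μ := μ) ht x₁ x₂ r c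
    simp only [hr, ← hT, wbMinus, wcMinus] at e
    simp only [Matrix.mulVec, dotProduct, Finset.mul_sum, ← Finset.sum_sub_distrib]
    refine Finset.sum_congr rfl fun c _ => ?_
    have e' := e c
    unfold exchangeCoeff
    rw [add_comm T (x₁ - x₂)] at e'
    field_simp at e' ⊢
    linear_combination ψ c * e'
  -- In rows of any other weight every term vanishes: `w₁` and `w₂` are the weights lowered by the
  -- two factors, `2` for `B` and `0` for `D`.
  · have hB (M₁ M₂ : Matrix (Config L) (Config L) ℂ) (w₁ w₂ : ℂ) (hw : w₁ + w₂ = 2)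
        (h₁ : ∀ r c, totalWeight r + w₁ ≠ totalWeight c → M₁ r c = 0)
        (h₂ : ∀ r c, totalWeight r + w₂ ≠ totalWeight c → M₂ r c = 0) :
        ((M₁ * M₂).mulVec ψ) r = 0 := by
      rw [Matrix.mulVec, dotProduct]
      refine Finset.sum_eq_zero fun c _ => ?_
      rw [Matrix.mul_apply, Finset.sum_mul]
      refine Finset.sum_eq_zero fun s _ => ?_
      by_cases hc : totalWeight c = L - 2 * n
      · by_cases hs : totalWeight s + w₂ = totalWeight c
        · rw [h₁ r s fun h' => hr (by linear_combination h' + hs + hc - hw), zero_mul, zero_mul]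
        · rw [h₂ s c hs, mul_zero, zero_mul]
      · rw [hψ c hc, mul_zero]
    have hb (x t : ℂ) (r c : Config L) : totalWeight r + 2 ≠ totalWeight c →
        opB p γ μ x t r c = 0 := opB_eq_zero
    have hd (x t : ℂ) (r c : Config L) (h : totalWeight r + 0 ≠ totalWeight c) :
        opD p γ μ x t r c = 0 := opD_eq_zero (by rwa [add_zero] at h)
    rw [hB _ _ 0 2 (by ring) (hd _ _) (hb _ _), hB _ _ 2 0 (by ring) (hb _ _) (hd _ _),
      hB _ _ 2 0 (by ring) (hb _ _) (hd _ _)]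
    ring

/-- The Bethe vector whose spectral parameters are labelled by a finite set. -/
def betheFinset {L : ℕ} {ι : Type*} (p : ℝ) (γ : ℂ) (μ : Fin L → ℂ) (x : ι → ℂ) (s : Finset ι)
    (t : ℂ) : Config L → ℂ :=
  betheVector p γ μ (s.toList.map x) t

lemma betheFinset_insert {L : ℕ} {ι : Type*} [DecidableEq ι] {p : ℝ} (hp0 : 0 < p) (hp1 : p < 1)
    {γ : ℂ} {μ : Fin L → ℂ} (x : ι → ℂ) {a : ι} {s : Finset ι} (ha : a ∉ s) {t : ℂ}
    (ht : ∀ n : ℤ, theta p (t + n * γ) ≠ 0) :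
    betheFinset p γ μ x (insert a s) t =
      (opB p γ μ (x a) t).mulVec (betheFinset p γ μ x s (t + γ)) :=
  betheVector_perm hp0 hp1 ((Finset.toList_insert ha).map x) ht

/-- The coefficient of the direct term in the action of `D` on a Bethe vector. -/
def directCoeff {L : ℕ} {ι : Type*} (p : ℝ) (γ : ℂ) (μ : Fin L → ℂ) (x : ι → ℂ) (a : ι)
    (s : Finset ι) : ℂ :=
  (∏ j ∈ s, theta p (x a - x j + γ) / theta p (x a - x j)) * ∏ k, theta p (x a - μ k)

/-- The action of `D` on a Bethe vector. -/
lemma opD_mulVec_betheFinset {L : ℕ} {ι : Type*} [DecidableEq ι] {p : ℝ} (hp0 : 0 < p)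
    (hp1 : p < 1) {γ : ℂ} (μ : Fin L → ℂ) (x : ι → ℂ)
    (hx : ∀ i j, i ≠ j → theta p (x i - x j) ≠ 0) (s : Finset ι) {a : ι} (ha : a ∉ s) {t : ℂ}
    (ht : ∀ n : ℤ, theta p (t + n * γ) ≠ 0) {T : ℂ} (hT : T = t - γ * (L - 2 * s.card)) :
    (opD p γ μ (x a) t).mulVec (betheFinset p γ μ x s (t + γ)) =
      (theta p (t + (s.card + 1) * γ) / theta p (T + γ)) •
        (directCoeff p γ μ x a s • betheFinset p γ μ x s t -
          ∑ i ∈ s, (exchangeCoeff p γ (x a - x i) T * directCoeff p γ μ x i (s.erase i)) •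
            betheFinset p γ μ x (insert a (s.erase i)) t) := by
  induction s using Finset.induction_on generalizing a t T with
  | empty =>
    have h : betheFinset p γ μ x ∅ = fun _ => vacuum L := by
      ext; simp [betheFinset, betheVector]
    rw [h, opD_mulVec_vacuum μ (x a) ht, hT]
    simp only [directCoeff, Finset.prod_empty, one_mul, Finset.sum_empty, sub_zero, smul_smul,
      Finset.card_empty, Nat.cast_zero, mul_zero, zero_add, mul_comm γ]
  | insert b s hb ih =>
    have hab : a ≠ b := fun h => ha (h ▸ Finset.mem_insert_self _ _)
    have has : a ∉ s := fun h => ha (Finset.mem_insert_of_mem h)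
    -- Removing `b` lowers `T` by `2γ`, while passing from `t` to `t + γ` raises it by `γ`. The
    -- prefactor `[T]/[T+γ]` then telescopes against the denominator `[T]` from the induction
    -- hypothesis.
    have hT' : T - γ = t + γ - γ * (L - 2 * s.card) := by
      rw [hT, Finset.card_insert_of_notMem hb]; push_cast; ring
    have hT0 : theta p T ≠ 0 := by
      convert ht (-L + 2 * (s.card + 1)) using 2
      rw [hT, Finset.card_insert_of_notMem hb]; push_cast; ring
    have hT1 : theta p (T - γ) ≠ 0 := by
      convert ht (-L + 2 * (s.card + 1) - 1) using 2
      rw [hT, Finset.card_insert_of_notMem hb]; push_cast; ring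
    have hψ (c : Config L) (hc : totalWeight c ≠ L - 2 * s.card) :
        betheFinset p γ μ x s (t + γ + γ) c = 0 :=
      betheVector_eq_zero (by rwa [List.length_map, Finset.length_toList])
    have hN : t + γ + (s.card + 1) * γ = t + ((insert b s).card + 1) * γ := by
      rw [Finset.card_insert_of_notMem hb]; push_cast; ring
    rw [betheFinset_insert hp0 hp1 x hb (generic_add ht),
      opD_mulVec_opB_mulVec hp0 hp1 ht (hx a b hab) hψ (T := T)
        (by rw [hT, Finset.card_insert_of_notMem hb]; push_cast; ring),
      ih has (generic_add ht) hT', ih hb (generic_add ht) hT', hN, sub_add_cancel]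
    generalize theta p (t + ((insert b s).card + 1) * γ) = N
    have hvec (i : ι) (hi : i ∈ s) : (opB p γ μ (x b) t).mulVec
        (betheFinset p γ μ x (insert a (s.erase i)) (t + γ)) =
          betheFinset p γ μ x (insert a ((insert b s).erase i)) t := by
      have hib : i ≠ b := fun h => hb (h ▸ hi)
      rw [Finset.erase_insert_of_ne hib.symm, Finset.insert_comm, betheFinset_insert hp0 hp1 x _ ht]
      simp [hab.symm, hb]
    have hvec' (i : ι) (hi : i ∈ s) : (opB p γ μ (x a) t).mulVec
        (betheFinset p γ μ x (insert b (s.erase i)) (t + γ)) =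
          betheFinset p γ μ x (insert a ((insert b s).erase i)) t := by
      have hib : i ≠ b := fun h => hb (h ▸ hi)
      rw [Finset.erase_insert_of_ne hib.symm, betheFinset_insert hp0 hp1 x _ ht]
      simp [hab, has]
    have hsum₁ : ∑ i ∈ s, (exchangeCoeff p γ (x a - x i) (T - γ) *
          directCoeff p γ μ x i (s.erase i)) • (opB p γ μ (x b) t).mulVec
            (betheFinset p γ μ x (insert a (s.erase i)) (t + γ)) =
        ∑ i ∈ s, (exchangeCoeff p γ (x a - x i) (T - γ) *
          directCoeff p γ μ x i (s.erase i)) •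
            betheFinset p γ μ x (insert a ((insert b s).erase i)) t :=
      Finset.sum_congr rfl fun i hi => by rw [hvec i hi]
    have hsum₂ : ∑ i ∈ s, (exchangeCoeff p γ (x b - x i) (T - γ) *
          directCoeff p γ μ x i (s.erase i)) • (opB p γ μ (x a) t).mulVec
            (betheFinset p γ μ x (insert b (s.erase i)) (t + γ)) =
        ∑ i ∈ s, (exchangeCoeff p γ (x b - x i) (T - γ) *
          directCoeff p γ μ x i (s.erase i)) •
            betheFinset p γ μ x (insert a ((insert b s).erase i)) t :=
      Finset.sum_congr rfl fun i hi => by rw [hvec' i hi]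
    simp only [Matrix.mulVec_smul, Matrix.mulVec_sub, Matrix.mulVec_sum]
    rw [← betheFinset_insert hp0 hp1 x hb ht, ← betheFinset_insert hp0 hp1 x has ht,
      hsum₁, hsum₂, Finset.sum_insert hb, Finset.erase_insert hb]
    have hA : directCoeff p γ μ x a (insert b s) =
        theta p (x a - x b + γ) / theta p (x a - x b) * directCoeff p γ μ x a s := by
      rw [directCoeff, directCoeff, Finset.prod_insert hb, mul_assoc]
    -- An exchange with `x i` occurs either after `D(x a)` passes `B(x b)` directly, or after it is
    -- first exchanged with `B(x b)`. The two contributions combine by `exchangeCoeff_relation` with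
    -- `u = x a - x b` and `v = x b - x i`.
    have hsum : ∑ i ∈ s, (exchangeCoeff p γ (x a - x i) T *
          directCoeff p γ μ x i ((insert b s).erase i)) •
            betheFinset p γ μ x (insert a ((insert b s).erase i)) t =
        (theta p (x a - x b + γ) / theta p (x a - x b)) •
          (∑ i ∈ s, (exchangeCoeff p γ (x a - x i) (T - γ) * directCoeff p γ μ x i (s.erase i)) •
            betheFinset p γ μ x (insert a ((insert b s).erase i)) t) -
        exchangeCoeff p γ (x a - x b) T •
          ∑ i ∈ s, (exchangeCoeff p γ (x b - x i) (T - γ) * directCoeff p γ μ x i (s.erase i)) •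
            betheFinset p γ μ x (insert a ((insert b s).erase i)) t := by
      rw [Finset.smul_sum, Finset.smul_sum, ← Finset.sum_sub_distrib]
      refine Finset.sum_congr rfl fun i hi => ?_
      have hib : i ≠ b := fun h => hb (h ▸ hi)
      have hia : a ≠ i := fun h => has (h ▸ hi)
      have hr := exchangeCoeff_relation hp0 hp1 γ (x a - x b) (x b - x i) T hT0 hT1
        (hx a b hab) (hx b i hib.symm) (by rw [sub_add_sub_cancel]; exact hx a i hia)
      rw [sub_add_sub_cancel, neg_sub] at hr
      have hAi : directCoeff p γ μ x i ((insert b s).erase i) =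
          theta p (x i - x b + γ) / theta p (x i - x b) * directCoeff p γ μ x i (s.erase i) := by
        rw [Finset.erase_insert_of_ne hib.symm, directCoeff, directCoeff, Finset.prod_insert,
          mul_assoc]
        simp [hb]
      rw [hAi, smul_smul, smul_smul, ← sub_smul]
      congr 1
      linear_combination -directCoeff p γ μ x i (s.erase i) * hr
    rw [hA, hsum]
    ext r
    simp only [Pi.smul_apply, Pi.sub_apply, Pi.add_apply, smul_eq_mul]
    generalize theta p (x a - x b + γ) / theta p (x a - x b) = f
    field_simp
    ring

/-! ### Continuity in the dynamical parameter -/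

/-- The number of sites in the state `v₂`. -/
def downCount {L : ℕ} (c : Config L) : ℕ := ∑ k, (c k : ℕ)

lemma downCount_cons {L : ℕ} (c₀ : Fin 2) (c : Config L) :
    downCount (Fin.cons c₀ c : Config (L + 1)) = c₀ + downCount c := by
  simp [downCount, Fin.sum_univ_succ]

lemma downCount_le {L : ℕ} (c : Config L) : downCount c ≤ L :=
  (Finset.sum_le_card_nsmul _ _ 1 fun k _ => by have := (c k).2; omega).trans (by simp)

lemma totalWeight_eq {L : ℕ} (c : Config L) : totalWeight c = L - 2 * downCount c := by
  have h (a : Fin 2) : hWeight a = 1 - 2 * (a : ℕ) := by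
    fin_cases a <;> norm_num [hWeight]
  simp [totalWeight, downCount, h, Finset.mul_sum]

lemma continuousAt_Rmat {p : ℝ} (hp0 : 0 < p) (hp1 : p < 1) (γ x : ℂ) {t : ℂ}
    (ht : theta p t ≠ 0) (a b : Fin 2 × Fin 2) :
    ContinuousAt (fun t => Rmat p γ x t a b) t := by
  have h := continuous_theta hp0 hp1
  have h' : ContinuousAt (fun t => (theta p t)⁻¹) t := h.continuousAt.inv₀ ht
  obtain ⟨a₁, a₂⟩ := a
  obtain ⟨b₁, b₂⟩ := b
  fin_cases a₁ <;> fin_cases a₂ <;> fin_cases b₁ <;> fin_cases b₂ <;>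
    simp only [Fin.zero_eta, Fin.mk_one, Fin.isValue, Rmat_entries, wa, wbPlus, wbMinus, wcPlus,
      wcMinus] <;> first | exact continuousAt_const | exact ContinuousAt.mul (by fun_prop) h'

/-- The denominators sit at `t + (d - u)γ`, where `d` and `u` count the labels `1` and `0` of `r` to
the right of a site; `d ≤ downCount r` and `u ≤ L - downCount r` give the window. -/
lemma continuousAt_monodromy {p : ℝ} (hp0 : 0 < p) (hp1 : p < 1) {L : ℕ} {γ : ℂ} (μ : Fin L → ℂ)
    (x : ℂ) {t : ℂ} (r c : Config L) (a b : Fin 2)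
    (ht : ∀ j : ℤ, downCount r - L ≤ j → j ≤ downCount r → theta p (t + j * γ) ≠ 0) :
    ContinuousAt (fun t => monodromy p γ μ x t (a, r) (b, c)) t := by
  induction L generalizing a with
  | zero =>
    simp only [monodromy_zero]
    exact continuousAt_const
  | succ L ih =>
    induction r using Fin.consCases with | _ r₀ r
    induction c using Fin.consCases with | _ c₀ c
    have hd := downCount_le r
    have hr := r₀.2
    rw [downCount_cons] at ht
    simp only [monodromy_cons]
    refine tendsto_finsetSum _ fun d _ => ContinuousAt.mul ?_ ?_
    · refine ContinuousAt.comp (g := fun t => Rmat p γ (x - μ 0) t (a, r₀) (d, c₀))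
        (continuousAt_Rmat hp0 hp1 γ _ ?_ _ _) (by fun_prop)
      convert ht (2 * downCount r - L) (by push_cast; omega) (by push_cast; omega) using 2
      rw [totalWeight_eq]
      push_cast
      ring
    · exact ih _ _ _ _ fun j h1 h2 => ht j (by push_cast; omega) (by push_cast; omega)

/-- The top value `j = downCount r` would need all labels `1` of `r` to stand to the right of a site
labelled `0`, with none further right. As long as the outgoing labels are `0`, an auxiliary label
`0` meets only the weight `a_+`, so this denominator never occurs. -/
lemma continuousAt_monodromy_zero {p : ℝ} (hp0 : 0 < p) (hp1 : p < 1) {L : ℕ} {γ : ℂ}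
    (μ : Fin L → ℂ) (x : ℂ) {t : ℂ} (r c : Config L) (b : Fin 2)
    (ht : ∀ j : ℤ, downCount r - L ≤ j → j ≤ downCount r - 1 → theta p (t + j * γ) ≠ 0) :
    ContinuousAt (fun t => monodromy p γ μ x t (0, r) (b, c)) t := by
  induction L with
  | zero =>
    simp only [monodromy_zero]
    exact continuousAt_const
  | succ L ih =>
    induction r using Fin.consCases with | _ r₀ r
    induction c using Fin.consCases with | _ c₀ c
    have hd := downCount_le r
    rw [downCount_cons] at ht
    simp only [monodromy_cons]
    obtain rfl | rfl : r₀ = 0 ∨ r₀ = 1 := by fin_cases r₀ <;> simp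
    · have h := ih (Fin.tail μ) r c fun j h1 h2 =>
        ht j (by push_cast; omega) (by push_cast; simpa using h2)
      obtain rfl | rfl : c₀ = 0 ∨ c₀ = 1 := by fin_cases c₀ <;> simp
      · simp only [Fin.sum_univ_two, Rmat_entries, zero_mul, add_zero, wa]
        exact ContinuousAt.mul continuousAt_const h
      · simpa only [Fin.sum_univ_two, Rmat_entries, zero_mul, add_zero] using continuousAt_const
    · have hone : ((1 : Fin 2) : ℕ) = 1 := rfl
      rw [hone] at ht
      refine tendsto_finsetSum _ fun d _ => ContinuousAt.mul ?_ ?_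
      · refine ContinuousAt.comp (g := fun t => Rmat p γ (x - μ 0) t (0, 1) (d, c₀))
          (continuousAt_Rmat hp0 hp1 γ _ ?_ _ _) (by fun_prop)
        convert ht (2 * downCount r - L) (by push_cast; omega) (by push_cast; omega) using 2
        rw [totalWeight_eq]
        push_cast
        ring
      · exact continuousAt_monodromy hp0 hp1 _ _ _ _ _ _ fun j h1 h2 =>
          ht j (by push_cast; omega) (by push_cast; omega)

/-- Removing one `B` lowers the number of `1`s by one and raises `t` by `γ`, so the top of the
window of denominators is unchanged and the bottom does not go down. For `Z`, with `t = τ + γ` and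
`L` factors, the window is `τ + γ, …, τ + Lγ`. -/
lemma continuousAt_betheVector {p : ℝ} (hp0 : 0 < p) (hp1 : p < 1) {L : ℕ} {γ : ℂ}
    (μ : Fin L → ℂ) (l : List ℂ) {t : ℂ}
    (ht : ∀ j : ℤ, l.length - L ≤ j → j ≤ l.length - 1 → theta p (t + j * γ) ≠ 0)
    (c : Config L) : ContinuousAt (fun t => betheVector p γ μ l t c) t := by
  induction l generalizing t c with
  | nil => exact continuousAt_const
  | cons x l ih =>
    by_cases hc : totalWeight c = L - 2 * (x :: l).length
    · have hd : downCount c = (x :: l).length := by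
        rw [totalWeight_eq] at hc
        have : (downCount c : ℂ) = (x :: l).length := by linear_combination -hc / 2
        exact_mod_cast this
      simp only [betheVector, Matrix.mulVec, dotProduct]
      refine tendsto_finsetSum _ fun s _ => ContinuousAt.mul ?_ ?_
      · exact continuousAt_monodromy_zero hp0 hp1 μ x c s 1 (by rwa [hd])
      · refine ContinuousAt.comp (g := fun t => betheVector p γ μ l t s) (ih ?_ s) (by fun_prop)
        intro j h1 h2
        rw [List.length_cons] at ht
        convert ht (j + 1) (by push_cast; omega) (by push_cast; omega) using 2
        push_cast
        ring
    · simp only [betheVector_eq_zero hc]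
      exact continuousAt_const

lemma continuousAt_Z {p : ℝ} (hp0 : 0 < p) (hp1 : p < 1) {L : ℕ} {γ τ : ℂ} (μ x : Fin L → ℂ)
    (hτ : ∀ n : ℕ, 1 ≤ n → n ≤ L → theta p (τ + n * γ) ≠ 0) :
    ContinuousAt (fun τ => Z p γ μ τ x) τ := by
  simp only [Z_eq_betheVector]
  refine ContinuousAt.comp (g := fun t => betheVector p γ μ (List.ofFn x) t fun _ => 1)
    (continuousAt_betheVector hp0 hp1 μ _ ?_ _) (by fun_prop)
  intro j h1 h2
  rw [List.length_ofFn] at h1 h2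
  lift j to ℕ using by omega
  convert hτ (j + 1) (by omega) (by omega) using 2
  push_cast
  ring

/-! ### The functional equation -/

/-- The action of `D(x₀, τ + γ)` on the dual reference state and on a Bethe vector. -/
lemma dualVacuum_opD_betheVector {L : ℕ} {p : ℝ} (hp0 : 0 < p) (hp1 : p < 1) {γ τ : ℂ}
    (μ x : Fin L → ℂ) (x₀ : ℂ) (hτ : ∀ n : ℤ, theta p (τ + n * γ) ≠ 0)
    (hx : ∀ i j : Fin L, i ≠ j → theta p (x i - x j) ≠ 0)
    (hx₀ : ∀ j : Fin L, theta p (x₀ - x j) ≠ 0) :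
    (∏ k, theta p (x₀ - μ k + γ)) *
        betheVector p γ μ (List.ofFn x) (τ + γ + γ) (fun _ => 1) =
      (∏ j, theta p (x₀ - x j + γ) / theta p (x₀ - x j)) * (∏ k, theta p (x₀ - μ k)) *
          Z p γ μ τ x -
        ∑ i, exchangeCoeff p γ (x₀ - x i) (τ + (L + 1) * γ) *
          ((∏ j ∈ Finset.univ.erase i, theta p (x i - x j + γ) / theta p (x i - x j)) *
            ∏ k, theta p (x i - μ k)) * Z p γ μ τ (Function.update x i x₀) := by
  -- The label `none` carries the additional spectral parameter `x₀`.
  set X : Option (Fin L) → ℂ := fun o => o.elim x₀ x with hX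
  set S : Finset (Option (Fin L)) := Finset.univ.map Function.Embedding.some with hS
  have hXX (i j : Option (Fin L)) (h : i ≠ j) : theta p (X i - X j) ≠ 0 := by
    rcases i with _ | i <;> rcases j with _ | j
    · exact absurd rfl h
    · exact hx₀ j
    · have := hx₀ i
      rw [← neg_sub, theta_neg hp0, neg_ne_zero] at this
      exact this
    · exact hx i j fun h' => h (by rw [h'])
  have hcard : S.card = L := by simp [hS]
  have hT : τ + γ - γ * (L - 2 * (S.card : ℂ)) = τ + (L + 1) * γ := by rw [hcard]; ring
  have hnone : none ∉ S := by simp [hS]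
  have hgen := generic_add hτ
  have e := congrFun (opD_mulVec_betheFinset hp0 hp1 μ X hXX S hnone hgen hT.symm) fun _ => 1
  have hL : (opD p γ μ (X none) (τ + γ)).mulVec (betheFinset p γ μ X S (τ + γ + γ)) (fun _ => 1) =
      (∏ k, theta p (x₀ - μ k + γ)) * betheFinset p γ μ X S (τ + γ + γ) (fun _ => 1) := by
    simp [Matrix.mulVec, dotProduct, opD_dualVacuum, hX]
  have hS1 : (S.toList.map X).Perm (List.ofFn x) := by
    rw [← Multiset.coe_eq_coe, ← Multiset.map_coe, Finset.coe_toList, ← Fin.univ_val_map, hS,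
      Finset.map_val, Multiset.map_map]
    rfl
  have hS2 (i : Fin L) : ((insert none (S.erase (some i))).toList.map X).Perm
      (List.ofFn (Function.update x i x₀)) := by
    have h1 : S.erase (some i) = (Finset.univ.erase i).map Function.Embedding.some := by
      rw [Finset.map_erase]; rfl
    rw [← Multiset.coe_eq_coe, ← Multiset.map_coe, Finset.coe_toList, ← Fin.univ_val_map,
      Finset.insert_val_of_notMem (fun h => hnone (Finset.mem_of_mem_erase h)), h1,
      ← Finset.insert_erase (Finset.mem_univ i),
      Finset.insert_val_of_notMem (Finset.notMem_erase i _), Multiset.map_cons,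
      Multiset.map_cons, Function.update_self, Finset.map_val, Multiset.map_map,
      Finset.erase_insert (Finset.notMem_erase i _)]
    congr 1
    refine Multiset.map_congr rfl fun j hj => ?_
    rw [Function.update_of_ne (Finset.ne_of_mem_erase (Finset.mem_def.2 hj))]
    rfl
  -- With `L` operators `B` the final weight is `-L`, so `T = τ + (L+1)γ` and the prefactor becomes
  -- `[τ+(L+2)γ]/[τ+(L+2)γ]`.
  have hN : theta p (τ + γ + (S.card + 1) * γ) / theta p (τ + (L + 1) * γ + γ) = 1 := by
    have h := hτ (L + 2)
    rw [hcard, show τ + γ + (L + 1) * γ = τ + (L + 1) * γ + γ by ring]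
    refine div_self ?_
    convert h using 2
    push_cast
    ring
  have hd : directCoeff p γ μ X none S =
      (∏ j, theta p (x₀ - x j + γ) / theta p (x₀ - x j)) * ∏ k, theta p (x₀ - μ k) := by
    rw [directCoeff, hS, Finset.prod_map]
    rfl
  have hdi (i : Fin L) : directCoeff p γ μ X (some i) (S.erase (some i)) =
      (∏ j ∈ Finset.univ.erase i, theta p (x i - x j + γ) / theta p (x i - x j)) *
        ∏ k, theta p (x i - μ k) := by
    have h1 : S.erase (some i) = (Finset.univ.erase i).map Function.Embedding.some := by
      rw [Finset.map_erase]; rfl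
    rw [directCoeff, h1, Finset.prod_map]
    rfl
  have hsum (f : Option (Fin L) → Config L → ℂ) :
      (∑ o ∈ S, f o) (fun _ => 1) = ∑ i, f (some i) fun _ => 1 := by
    rw [hS, Finset.sum_map, Finset.sum_apply]
    rfl
  rw [hL, hN, one_smul, Pi.sub_apply, hsum, Pi.smul_apply, hd] at e
  simp only [Pi.smul_apply, hdi, smul_eq_mul, betheFinset, Z_eq_betheVector,
    betheVector_perm hp0 hp1 hS1 hgen, betheVector_perm hp0 hp1 hS1 (generic_add hgen),
    betheVector_perm hp0 hp1 (hS2 _) hgen] at e ⊢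
  exact e

end EllipticSOS

end

theorem theorem3
    (p : ℝ) (hp0 : 0 < p) (hp1 : p < 1)
    (L : ℕ) (hL : 1 ≤ L) (γ τ : ℂ) (μ x : Fin L → ℂ) (x₀ y : ℂ)
    (hτ : ∀ n : ℕ, 1 ≤ n → n ≤ L + 1 → EllipticSOS.theta p (τ + (n : ℂ) * γ) ≠ 0)
    (hx : ∀ i j : Fin L, i ≠ j → EllipticSOS.theta p (x i - x j) ≠ 0)
    (hx₀ : ∀ j : Fin L, EllipticSOS.theta p (x₀ - x j) ≠ 0)
    (hy : ∀ j : Fin L, EllipticSOS.theta p (y - x j) ≠ 0)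
    (hμ : ∀ j : Fin L, EllipticSOS.theta p (x₀ - μ j + γ) ≠ 0) :
    EllipticSOS.coeffM p γ μ x x₀ y * EllipticSOS.Z p γ μ τ x
      + ∑ i : Fin L, EllipticSOS.coeffN p γ μ τ x x₀ y i *
          EllipticSOS.Z p γ μ τ (Function.update x i x₀)
      + ∑ i : Fin L, EllipticSOS.coeffNbar p γ μ τ x y i *
          EllipticSOS.Z p γ μ τ (Function.update x i y) = 0 := by
  open EllipticSOS in
  have generic (τ : ℂ) (h : ∀ n : ℤ, theta p (τ + n * γ) ≠ 0) :
      coeffM p γ μ x x₀ y * Z p γ μ τ x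
        + ∑ i : Fin L, coeffN p γ μ τ x x₀ y i * Z p γ μ τ (Function.update x i x₀)
        + ∑ i : Fin L, coeffNbar p γ μ τ x y i * Z p γ μ τ (Function.update x i y) = 0 := by
    have e₀ := dualVacuum_opD_betheVector hp0 hp1 μ x x₀ h hx hx₀
    have e₁ := dualVacuum_opD_betheVector hp0 hp1 μ x y h hx hy
    have hP : ∏ k, theta p (x₀ - μ k + γ) ≠ 0 := Finset.prod_ne_zero_iff.2 fun k _ => hμ k
    set P := ∏ k, theta p (x₀ - μ k + γ) with hPdef
    set Q := ∏ k, theta p (y - μ k + γ) with hQdef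
    have hM : coeffM p γ μ x x₀ y =
        Q / P * ((∏ j, theta p (x₀ - x j + γ) / theta p (x₀ - x j)) *
          ∏ k, theta p (x₀ - μ k)) -
        (∏ j, theta p (y - x j + γ) / theta p (y - x j)) * ∏ k, theta p (y - μ k) := by
      simp only [coeffM, hPdef, hQdef, Finset.prod_div_distrib, Finset.prod_mul_distrib]
      ring
    have hN (i : Fin L) : coeffN p γ μ τ x x₀ y i =
        -(Q / P * (exchangeCoeff p γ (x₀ - x i) (τ + (L + 1) * γ) *
          ((∏ j ∈ Finset.univ.erase i, theta p (x i - x j + γ) / theta p (x i - x j)) *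
            ∏ k, theta p (x i - μ k)))) := by
      simp only [coeffN, exchangeCoeff, hPdef, hQdef, Finset.prod_div_distrib,
        Finset.prod_mul_distrib, add_assoc]
      ring
    have hN' (i : Fin L) : coeffNbar p γ μ τ x y i =
        exchangeCoeff p γ (y - x i) (τ + (L + 1) * γ) *
          ((∏ j ∈ Finset.univ.erase i, theta p (x i - x j + γ) / theta p (x i - x j)) *
            ∏ k, theta p (x i - μ k)) := by
      simp only [coeffNbar, exchangeCoeff, Finset.prod_div_distrib, add_assoc]
      ring
    simp only [hM, hN, hN', neg_mul, mul_assoc (Q / P), Finset.sum_neg_distrib, ← Finset.mul_sum]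
    -- This matrix element contains neither `x₀` nor `y`, hence is common to both equations;
    -- comparing `Q/P` times the first with the second eliminates it.
    generalize betheVector p γ μ (List.ofFn x) (τ + γ + γ) (fun _ => 1) = K at e₀ e₁
    have hQ : Q / P * (P * K) = Q * K := by field_simp
    rw [e₀, e₁] at hQ
    linear_combination hQ
  have hZ (x : Fin L → ℂ) : ContinuousAt (fun τ => EllipticSOS.Z p γ μ τ x) τ :=
    EllipticSOS.continuousAt_Z hp0 hp1 μ x fun n h1 h2 => hτ n h1 (by omega)
  have hc := EllipticSOS.continuous_theta hp0 hp1
  have hT : EllipticSOS.theta p (τ + ((L : ℂ) + 1) * γ) ≠ 0 := by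
    have := hτ (L + 1) (by omega) le_rfl
    push_cast at this
    exact this
  have hN (i : Fin L) : ContinuousAt (fun τ => EllipticSOS.coeffN p γ μ τ x x₀ y i) τ := by
    have h1 : EllipticSOS.theta p (τ + ((L : ℂ) + 1) * γ) * EllipticSOS.theta p (x₀ - x i) ≠ 0 :=
      mul_ne_zero hT (hx₀ i)
    unfold EllipticSOS.coeffN
    fun_prop (disch := assumption)
  have hN' (i : Fin L) : ContinuousAt (fun τ => EllipticSOS.coeffNbar p γ μ τ x y i) τ := by
    have h1 : EllipticSOS.theta p (τ + ((L : ℂ) + 1) * γ) * EllipticSOS.theta p (y - x i) ≠ 0 :=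
      mul_ne_zero hT (hy i)
    unfold EllipticSOS.coeffNbar
    fun_prop (disch := assumption)
  have hF : ContinuousAt (fun τ => EllipticSOS.coeffM p γ μ x x₀ y * EllipticSOS.Z p γ μ τ x
      + ∑ i : Fin L, EllipticSOS.coeffN p γ μ τ x x₀ y i *
          EllipticSOS.Z p γ μ τ (Function.update x i x₀)
      + ∑ i : Fin L, EllipticSOS.coeffNbar p γ μ τ x y i *
          EllipticSOS.Z p γ μ τ (Function.update x i y)) τ :=
    ((continuousAt_const.mul (hZ x)).add
      (tendsto_finsetSum _ fun i _ => (hN i).mul (hZ _))).add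
      (tendsto_finsetSum _ fun i _ => (hN' i).mul (hZ _))
  -- The left side is continuous at `τ` and vanishes at generic parameters, which are dense, so its
  -- value at `τ` lies in the closure of `{0}`. The condition at `n = L + 1` also shows that the
  -- theta function is not identically zero.
  have hd := EllipticSOS.dense_theta_shift_ne_zero hp0 hp1 hT fun n : ℤ => (n : ℂ) * γ
  have := (hF.continuousWithinAt (s := {τ | ∀ n : ℤ, EllipticSOS.theta p (τ + n * γ) ≠ 0})
    ).mem_closure (t := {0}) (hd τ) fun t ht => generic t ht
  simpa using this
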